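/- All graphs are finite, simple and undirected. For a graph $G$ and $X\subseteq V(G)$ let $\rho_G(X)$ be the rank over the two-element field $\mathbb F_2$ of the matrix with rows indexed by $X$ and columns indexed by $V(G)\setminus X$ whose entry at $(x,y)$ is $1$ if $xy\in E(G)$ and $0$ otherwise. A rank decomposition of $G$ is a finite rooted binary tree $T$ (every internal node has exactly two children) with a map $\gamma\colon V(T)\to 2^{V(G)}$ such that $\gamma(r)=V(G)$ for the root $r$, $\gamma(t)$ is the disjoint union of $\gamma(s_1)$ and $\gamma(s_2)$ for every internal node $t$ with children $s_1,s_2$, and $|\gamma(t)|=1$ for every leaf $t$. Its width is $\max_{t\in V(T)}\rho_G(\gamma(t))$, and the rank width $\operatorname{rw}(G)$ is the minimum width of a rank decomposition of $G$ (and $0$ for the graph without vertices). For $m\in\mathbb N$ let $\mathsf C^{m}$ be the set of those formulas of first-order logic with counting quantifiers that contain at most $m$ distinct variables (free or bound). Formulas are built from the atomic formulas $x=y$ and $E(x,y)$ by $\neg,\wedge,\vee,\exists x,\forall x$ and the counting quantifiers $\exists^{\ge i}x$ ($i\in\mathbb N$), where $\exists^{\ge i}x\,\varphi$ says that at least $i$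 distinct vertices satisfy $\varphi$. A sentence is a formula without free variables. For graphs whose vertices are coloured by a finite set $\mathcal C$ of colours, there are in addition atomic formulas $P_c(x)$, for $c\in\mathcal C$, saying that $x$ has colour $c$. **Corollary.** Let $k\in\mathbb N$ and let $G$ be a graph with $\operatorname{rw}(G)\le k$. 1. There is a sentence $\varphi_G$ of $\mathsf C^{3k+5}$ over the vocabulary $\{E\}$ such that for every graph $H$: $H\models\varphi_G$ if and only if $H\cong G$. 2. The same holds for coloured graphs: for every finite set $\mathcal C$ and every colouring $\chi\colon V(G)\to\mathcal C$ there is a sentence $\varphi_{G,\chi}$ of $\mathsf C^{3k+5}$ over the vocabulary $\{E\}\cup\{P_c : c\in\mathcal C\}$ such that for every graph $H$ with a colouring $\chi'\colon V(H)\to\mathcal C$: $(H,\chi')\models\varphi_{G,\chi}$ if and only if there is an isomorphism from $G$ to $H$ that preserves colours. -/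

import Mathlib

/-! ## Rank width -/

section RankWidth

variable {V : Type*}

open Classical in
/-- The matrix `M(X, Y)` over the two-element field: the entry at `(x, y)` is `1` if and only if
`x` and `y` are adjacent. -/
noncomputable def SimpleGraph.cutMatrix (G : SimpleGraph V) (X Y : Set V) :
    Matrix X Y (ZMod 2) :=
  Matrix.of fun x y => if G.Adj x y then 1 else 0

open Classical in
/-- The cut rank `ρ_G(X)`, the rank over `𝔽₂` of the matrix `M(X, V \ X)`. -/
noncomputable def SimpleGraph.cutRank [Fintype V] (G : SimpleGraph V) (X : Set V) : ℕ :=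
  (G.cutMatrix X Xᶜ).rank

/-- Binary rooted trees (every internal node has exactly two children) in which every node `t`
carries a set `γ(t)` of vertices. -/
inductive SetTree (V : Type*) : Type _
  | leaf (X : Set V) : SetTree V
  | node (X : Set V) (l r : SetTree V) : SetTree V

/-- The set `γ(r)` at the root `r` of the tree. -/
def SetTree.root : SetTree V → Set V
  | .leaf X => X
  | .node X _ _ => X

/-- The set at every internal node is the disjoint union of the sets at its two children,
and the set at every leaf has exactly one element. -/
def SetTree.Valid : SetTree V → Prop
  | .leaf X => X.ncard = 1
  | .node X l r => X = l.root ∪ r.root ∧ l.root ∩ r.root = ∅ ∧ l.Valid ∧ r.Valid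

/-- A rank decomposition of a graph with vertex set `V`. -/
def SetTree.IsRankDecomposition (T : SetTree V) : Prop :=
  T.root = Set.univ ∧ T.Valid

/-- The width of a decomposition: the maximum of `ρ_G(γ(t))` over all nodes `t`. -/
noncomputable def SetTree.width [Fintype V] (G : SimpleGraph V) : SetTree V → ℕ
  | .leaf X => G.cutRank X
  | .node X l r => max (G.cutRank X) (max (l.width G) (r.width G))

/-- The rank width of a finite graph: the minimum width of a rank decomposition. Every graph with
at least one vertex has a rank decomposition; the graph without vertices has none, and its
rank width is `0` by convention. -/
noncomputable def SimpleGraph.rankWidth [Fintype V] (G : SimpleGraph V) : ℕ :=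
  sInf {w | ∃ T : SetTree V, T.IsRankDecomposition ∧ T.width G = w}

end RankWidth

/-! ## First-order logic with counting quantifiers -/

/-- Formulas of first-order logic with counting quantifiers `∃^{≥ i} x`, over the vocabulary with
equality, one binary relation symbol `E` and one unary relation symbol for every element of `C`.
The variables are indexed by natural numbers. For `C = Empty` the vocabulary is `{E}`. -/
inductive CFormula (C : Type*) : Type _
  | eq (x y : ℕ) : CFormula C
  | edge (x y : ℕ) : CFormula C
  | colour (c : C) (x : ℕ) : CFormula C
  | neg (φ : CFormula C) : CFormula C
  | and (φ ψ : CFormula C) : CFormula C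
  | or (φ ψ : CFormula C) : CFormula C
  | ex (x : ℕ) (φ : CFormula C) : CFormula C
  | all (x : ℕ) (φ : CFormula C) : CFormula C
  | exGE (i : ℕ) (x : ℕ) (φ : CFormula C) : CFormula C

namespace CFormula

variable {C V : Type*}

/-- The variables that occur in a formula, free or bound (including those occurring only next to
a quantifier). -/
def vars : CFormula C → Finset ℕ
  | eq x y => {x, y}
  | edge x y => {x, y}
  | colour _ x => {x}
  | neg φ => φ.vars
  | and φ ψ => φ.vars ∪ ψ.vars
  | or φ ψ => φ.vars ∪ ψ.vars
  | ex x φ => insert x φ.vars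
  | all x φ => insert x φ.vars
  | exGE _ x φ => insert x φ.vars

/-- The free variables of a formula. -/
def freeVars : CFormula C → Finset ℕ
  | eq x y => {x, y}
  | edge x y => {x, y}
  | colour _ x => {x}
  | neg φ => φ.freeVars
  | and φ ψ => φ.freeVars ∪ ψ.freeVars
  | or φ ψ => φ.freeVars ∪ ψ.freeVars
  | ex x φ => φ.freeVars.erase x
  | all x φ => φ.freeVars.erase x
  | exGE _ x φ => φ.freeVars.erase x

/-- `φ` is a sentence of the `m`-variable fragment `C^m`: it has no free variables and at most `m`
distinct variables occur in it. -/
def IsSentenceOfC (m : ℕ) (φ : CFormula C) : Prop :=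
  φ.freeVars = ∅ ∧ φ.vars.card ≤ m

/-- Satisfaction of a formula in the graph `G` whose unary relations are given by `P`, under a
partial assignment `a` of vertices to variables. The assignment is partial so that sentences can be
evaluated in every graph, including the one without vertices; an atomic formula with an unassigned
variable is false, which never happens in the evaluation of a sentence. -/
def Realize (G : SimpleGraph V) (P : C → V → Prop) : (ℕ → Option V) → CFormula C → Prop
  | a, eq x y => ∃ v, a x = some v ∧ a y = some v
  | a, edge x y => ∃ v w, a x = some v ∧ a y = some w ∧ G.Adj v w
  | a, colour c x => ∃ v, a x = some v ∧ P c v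
  | a, neg φ => ¬ Realize G P a φ
  | a, and φ ψ => Realize G P a φ ∧ Realize G P a ψ
  | a, or φ ψ => Realize G P a φ ∨ Realize G P a ψ
  | a, ex x φ => ∃ v, Realize G P (Function.update a x (some v)) φ
  | a, all x φ => ∀ v, Realize G P (Function.update a x (some v)) φ
  | a, exGE i x φ =>
      ∃ s : Finset V, s.card = i ∧ ∀ v ∈ s, Realize G P (Function.update a x (some v)) φ

/-- Truth of a sentence over the vocabulary `{E}` in a graph. -/
def Models (G : SimpleGraph V) (φ : CFormula Empty) : Prop :=
  Realize G (fun c _ => c.elim) (fun _ => none) φ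

/-- Truth of a sentence in a vertex-coloured graph: the unary relation symbol of the colour `c`
is interpreted by the set of vertices of colour `c`. -/
def ModelsColoured (G : SimpleGraph V) (χ : V → C) (φ : CFormula C) : Prop :=
  Realize G (fun c v => χ v = c) (fun _ => none) φ

end CFormula

/-! If no formula with `m` variables distinguishes `G` from `H`, then Duplicator survives the
bijective game with `m` pebbles. The core is to turn her strategy into an isomorphism when `3 * k +
3 ≤ m` (`IsPebbleSystem.exists_iso`). As there are only finitely many coloured graphs of the order
of `G` up to isomorphism, finitely many distinguishing sentences combine to one
(`CFormula.exists_sentence`).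

The isomorphism is built bottom-up along a rank decomposition. At a node with set `X`, the pebbles
lie on a split pair: a row basis `A` and a spanning set of columns `B` of the cut matrix, each of
size at most `k`. Adjacency across the cut is determined by the neighbours among the pebbles, hence
by the stable colours of colour refinement with individualised pebbles. Complementing adjacency
between suitable pairs of colours thus removes all edges across the cut
(`SimpleGraph.exists_separates`), so components of the flipped graph that meet `X` lie in `X`.
Duplicator respects stable colours and, with three spare pebbles, also connectedness in the flipped
graph.

The induction (`IsPebbleSystem.exists_typedIso`) shows that components of corresponding vertices are
isomorphic with colours preserved. If `X` is split into `X₁` and `X₂`, split pairs of both parts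
exist inside `A₁ ∪ A₂ ∪ B`, which costs `3 * k` pebbles. One flip over these pebbles
(`SimpleGraph.exists_common_flip`) cuts a component into pieces inside `X₁` or `X₂`. The
isomorphisms for the parts restrict to the pieces (`restrict_typedIso`), counting matches the pieces
of both graphs (`exists_equiv_quotient`), and adjacency between different pieces depends on colours
only, so everything glues (`glue_typedIso`). At the root no pebbles are needed: a graph or its
complement is connected, so one component is the whole graph. -/

/-! ## Split pairs -/

open Classical in
/-- The row of the adjacency matrix at `u`, restricted to the columns in `Y`. -/
noncomputable def SimpleGraph.nbrVec {V : Type*} (G : SimpleGraph V) (Y : Set V) (u : V) :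
    Y → ZMod 2 :=
  fun y => if G.Adj u y then 1 else 0

/-- `A ⊆ X` indexes a basis of the row space and `B ⊆ Xᶜ` a small spanning set of the column
space of the matrix `M(X, Xᶜ)`. -/
structure SimpleGraph.IsSplitPair {V : Type*} [Fintype V] (G : SimpleGraph V)
    (X A B : Set V) : Prop where
  left_subset : A ⊆ X
  right_subset : B ⊆ Xᶜ
  indep : LinearIndepOn (ZMod 2) (G.nbrVec Xᶜ) A
  left_spans : ∀ u ∈ X, G.nbrVec Xᶜ u ∈ Submodule.span (ZMod 2) (G.nbrVec Xᶜ '' A)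
  right_spans : ∀ w ∈ Xᶜ, G.nbrVec X w ∈ Submodule.span (ZMod 2) (G.nbrVec X '' B)
  right_card : B.ncard ≤ G.cutRank X

namespace SimpleGraph

variable {V : Type*} (G : SimpleGraph V)

/-- Restriction of vectors to fewer coordinates. -/
def restrictCoords {Y' Y : Set V} (h : Y' ⊆ Y) : (Y → ZMod 2) →ₗ[ZMod 2] (Y' → ZMod 2) :=
  LinearMap.funLeft (ZMod 2) (ZMod 2) (Set.inclusion h)

theorem nbrVec_mem_span_mono {G : SimpleGraph V} {Y' Y S : Set V} (h : Y' ⊆ Y) {w : V}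
    (hw : G.nbrVec Y w ∈ Submodule.span (ZMod 2) (G.nbrVec Y '' S)) :
    G.nbrVec Y' w ∈ Submodule.span (ZMod 2) (G.nbrVec Y' '' S) := by
  have := Submodule.mem_map_of_mem (f := restrictCoords h) hw
  rw [Submodule.map_span, Set.image_image] at this
  exact this

theorem linearIndepOn_nbrVec_mono {G : SimpleGraph V} {Y' Y S : Set V} (h : Y' ⊆ Y)
    (hS : LinearIndepOn (ZMod 2) (G.nbrVec Y') S) : LinearIndepOn (ZMod 2) (G.nbrVec Y) S :=
  LinearIndependent.of_comp (restrictCoords h) hS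

/-- If two vertices have the same neighbours among a spanning set of the columns, then they
have the same neighbours in all columns. -/
theorem adj_iff_of_spans {G : SimpleGraph V} {Y S : Set V} {u₁ u₂ w : V}
    (hw : G.nbrVec Y w ∈ Submodule.span (ZMod 2) (G.nbrVec Y '' S)) (h₁ : u₁ ∈ Y) (h₂ : u₂ ∈ Y)
    (h : ∀ s ∈ S, (G.Adj u₁ s ↔ G.Adj u₂ s)) : G.Adj u₁ w ↔ G.Adj u₂ w := by
  classical
  have key : ∀ x ∈ Submodule.span (ZMod 2) (G.nbrVec Y '' S), x ⟨u₁, h₁⟩ = x ⟨u₂, h₂⟩ := by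
    intro x hx
    induction hx using Submodule.span_induction with
    | mem x hx =>
      obtain ⟨s, hs, rfl⟩ := hx
      simp only [nbrVec, G.adj_comm s, h s hs]
    | zero => rfl
    | add x y _ _ hx hy => simp [hx, hy]
    | smul a x _ hx => simp [hx]
  have := key _ hw
  simp only [nbrVec, G.adj_comm w] at this
  by_cases h1 : G.Adj u₁ w <;> by_cases h2 : G.Adj u₂ w <;> simp_all

theorem exists_left_basis (X A : Set V) (hA : A ⊆ X)
    (hi : LinearIndepOn (ZMod 2) (G.nbrVec Xᶜ) A) :
    ∃ A' ⊆ X, A ⊆ A' ∧ LinearIndepOn (ZMod 2) (G.nbrVec Xᶜ) A' ∧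
      ∀ u ∈ X, G.nbrVec Xᶜ u ∈ Submodule.span (ZMod 2) (G.nbrVec Xᶜ '' A') := by
  refine ⟨hi.extend hA, hi.extend_subset hA, hi.subset_extend hA, hi.linearIndepOn_extend hA,
    fun u hu => ?_⟩
  rw [hi.span_image_extend_eq_span_image hA]
  exact Submodule.subset_span ⟨u, hu, rfl⟩

section

variable [Fintype V]

theorem ncard_le_finrank_span {M : Type*} [AddCommGroup M] [Module (ZMod 2) M]
    [Module.Finite (ZMod 2) M] (v : V → M) {A X : Set V} (hA : LinearIndepOn (ZMod 2) v A)
    (hX : A ⊆ X) : A.ncard ≤ Module.finrank (ZMod 2) (Submodule.span (ZMod 2) (v '' X)) := by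
  classical
  have h := finrank_span_eq_card (R := ZMod 2) hA
  rw [← Nat.card_eq_fintype_card, Nat.card_coe_set_eq] at h
  rw [← h]
  apply Submodule.finrank_mono
  apply Submodule.span_mono
  rintro _ ⟨a, rfl⟩
  exact ⟨a, hX a.2, rfl⟩

theorem cutRank_eq_finrank_rows (X : Set V) :
    G.cutRank X = Module.finrank (ZMod 2) (Submodule.span (ZMod 2) (G.nbrVec Xᶜ '' X)) := by
  classical
  have h : Set.range (G.cutMatrix X Xᶜ).row = G.nbrVec Xᶜ '' X := by
    rw [Set.image_eq_range]
    rfl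
  rw [cutRank, Matrix.rank_eq_finrank_span_row, h]

theorem cutRank_eq_finrank_cols (X : Set V) :
    G.cutRank X = Module.finrank (ZMod 2) (Submodule.span (ZMod 2) (G.nbrVec X '' Xᶜ)) := by
  classical
  have h : Set.range (G.cutMatrix X Xᶜ).col = G.nbrVec X '' Xᶜ := by
    rw [Set.image_eq_range]
    congr 1
    funext w x
    simp [nbrVec, cutMatrix, Matrix.col, G.adj_comm]
  rw [cutRank, Matrix.rank_eq_finrank_span_cols, h]

theorem IsSplitPair.left_card {G : SimpleGraph V} {X A B : Set V} (h : G.IsSplitPair X A B) :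
    A.ncard ≤ G.cutRank X := by
  rw [cutRank_eq_finrank_rows]
  exact ncard_le_finrank_span _ h.indep h.left_subset

theorem IsSplitPair.adj_congr_left {G : SimpleGraph V} {X A B : Set V} (h : G.IsSplitPair X A B)
    {u₁ u₂ w : V} (h₁ : u₁ ∈ X) (h₂ : u₂ ∈ X) (hw : w ∉ X)
    (hB : ∀ b ∈ B, (G.Adj u₁ b ↔ G.Adj u₂ b)) : G.Adj u₁ w ↔ G.Adj u₂ w :=
  adj_iff_of_spans (h.right_spans w hw) h₁ h₂ hB

theorem IsSplitPair.adj_congr_right {G : SimpleGraph V} {X A B : Set V}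
    (h : G.IsSplitPair X A B) {u w₁ w₂ : V} (hu : u ∈ X) (h₁ : w₁ ∉ X) (h₂ : w₂ ∉ X)
    (hA : ∀ a ∈ A, (G.Adj w₁ a ↔ G.Adj w₂ a)) : G.Adj u w₁ ↔ G.Adj u w₂ := by
  rw [G.adj_comm u, G.adj_comm u]
  exact adj_iff_of_spans (h.left_spans u hu) h₁ h₂ hA

theorem isSplitPair_univ : G.IsSplitPair Set.univ ∅ ∅ where
  left_subset := by simp
  right_subset := by simp
  indep := linearIndepOn_empty _ _
  left_spans u _ := by
    have : G.nbrVec Set.univᶜ u = 0 := by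
      funext y
      exact absurd (Set.mem_univ _) y.2
    rw [this]
    exact Submodule.zero_mem _
  right_spans w hw := absurd (Set.mem_univ w) hw
  right_card := by simp

theorem exists_right_spanning (X S : Set V) (hS : S ⊆ Xᶜ)
    (hs : ∀ w ∈ Xᶜ, G.nbrVec X w ∈ Submodule.span (ZMod 2) (G.nbrVec X '' S)) :
    ∃ B ⊆ S, B.ncard ≤ G.cutRank X ∧
      ∀ w ∈ Xᶜ, G.nbrVec X w ∈ Submodule.span (ZMod 2) (G.nbrVec X '' B) := by
  have hi := linearIndepOn_empty (ZMod 2) (G.nbrVec X)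
  refine ⟨hi.extend (Set.empty_subset S), hi.extend_subset _, ?_, ?_⟩
  · rw [cutRank_eq_finrank_cols]
    exact ncard_le_finrank_span _ (hi.linearIndepOn_extend _) ((hi.extend_subset _).trans hS)
  · rwa [hi.span_image_extend_eq_span_image]

/-- A column outside `X₁` belongs to `X₂`, where it is a restricted row spanned by `A₂`, or lies
outside the union, where it is spanned by `B`. This lets the pebbles for one part be reused for the
other. -/
theorem right_spans_child {G : SimpleGraph V} {X₁ X₂ A B A₂ : Set V}
    (h : G.IsSplitPair (X₁ ∪ X₂) A B) (hd : Disjoint X₁ X₂)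
    (h₂ : ∀ u ∈ X₂, G.nbrVec X₂ᶜ u ∈ Submodule.span (ZMod 2) (G.nbrVec X₂ᶜ '' A₂)) :
    ∀ w ∈ X₁ᶜ, G.nbrVec X₁ w ∈ Submodule.span (ZMod 2) (G.nbrVec X₁ '' (A₂ ∪ B)) := by
  intro w hw
  by_cases hw2 : w ∈ X₂
  · have := nbrVec_mem_span_mono hd.subset_compl_right (h₂ w hw2)
    exact Submodule.span_mono (Set.image_mono Set.subset_union_left) this
  · have := nbrVec_mem_span_mono Set.subset_union_left (h.right_spans w (by simp_all))
    exact Submodule.span_mono (Set.image_mono Set.subset_union_right) this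

/-- A split pair of a disjoint union induces compatible split pairs of the two parts. -/
theorem IsSplitPair.exists_children {G : SimpleGraph V} {X₁ X₂ A B : Set V}
    (h : G.IsSplitPair (X₁ ∪ X₂) A B) (hd : Disjoint X₁ X₂) :
    ∃ A₁ A₂ B₁ B₂ : Set V, G.IsSplitPair X₁ A₁ B₁ ∧ G.IsSplitPair X₂ A₂ B₂ ∧
      A ⊆ A₁ ∪ A₂ ∧ B₁ ⊆ A₂ ∪ B ∧ B₂ ⊆ A₁ ∪ B := by
  -- Passing to a part discards rows and adds columns, and both preserve independence.
  have hi : ∀ X' ⊆ X₁ ∪ X₂, LinearIndepOn (ZMod 2) (G.nbrVec X'ᶜ) (A ∩ X') := fun X' hX' =>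
    linearIndepOn_nbrVec_mono (Set.compl_subset_compl.2 hX') (h.indep.mono Set.inter_subset_left)
  obtain ⟨A₁, hA₁, hAA₁, hi₁, hs₁⟩ := G.exists_left_basis X₁ (A ∩ X₁) Set.inter_subset_right
    (hi X₁ Set.subset_union_left)
  obtain ⟨A₂, hA₂, hAA₂, hi₂, hs₂⟩ := G.exists_left_basis X₂ (A ∩ X₂) Set.inter_subset_right
    (hi X₂ Set.subset_union_right)
  have hB := h.right_subset
  obtain ⟨B₁, hB₁, hc₁, hr₁⟩ := G.exists_right_spanning X₁ (A₂ ∪ B)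
    (Set.union_subset (hA₂.trans hd.subset_compl_left)
      (hB.trans (Set.compl_subset_compl.2 Set.subset_union_left)))
    (right_spans_child h hd hs₂)
  obtain ⟨B₂, hB₂, hc₂, hr₂⟩ := G.exists_right_spanning X₂ (A₁ ∪ B)
    (Set.union_subset (hA₁.trans hd.subset_compl_right)
      (hB.trans (Set.compl_subset_compl.2 Set.subset_union_right)))
    (right_spans_child (by rwa [Set.union_comm]) hd.symm hs₁)
  refine ⟨A₁, A₂, B₁, B₂, ⟨hA₁, ?_, hi₁, hs₁, hr₁, hc₁⟩, ⟨hA₂, ?_, hi₂, hs₂, hr₂, hc₂⟩,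
    ?_, hB₁, hB₂⟩
  · exact hB₁.trans (Set.union_subset (hA₂.trans hd.subset_compl_left)
      (hB.trans (Set.compl_subset_compl.2 Set.subset_union_left)))
  · exact hB₂.trans (Set.union_subset (hA₁.trans hd.subset_compl_right)
      (hB.trans (Set.compl_subset_compl.2 Set.subset_union_right)))
  · intro a ha
    rcases h.left_subset ha with h1 | h1
    · exact Or.inl (hAA₁ ⟨ha, h1⟩)
    · exact Or.inr (hAA₂ ⟨ha, h1⟩)

end

end SimpleGraph

/-! ## Colour refinement -/

namespace SimpleGraph

/-- `u` and `u'` get the same colour in the first `n` rounds of colour refinement, started with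
the vertex colourings `c` and `d`. -/
def RefineEq {V W κ : Type*} (G : SimpleGraph V) (H : SimpleGraph W) (c : V → κ) (d : W → κ) :
    ℕ → V → W → Prop
  | 0, u, u' => c u = d u'
  | n + 1, u, u' => RefineEq G H c d n u u' ∧
      ∃ e : V ≃ W, ∀ y, (G.Adj u y ↔ H.Adj u' (e y)) ∧ RefineEq G H c d n y (e y)

/-- `u` and `u'` get the same colour in all rounds of colour refinement. -/
def StableEq {V W κ : Type*} (G : SimpleGraph V) (H : SimpleGraph W) (c : V → κ) (d : W → κ)
    (u : V) (u' : W) : Prop :=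
  ∀ n, RefineEq G H c d n u u'

variable {V W U κ κ' : Type*} {G : SimpleGraph V} {H : SimpleGraph W} {K : SimpleGraph U}
  {c : V → κ} {d : W → κ} {e : U → κ}

theorem RefineEq.refl (n : ℕ) (u : V) : RefineEq G G c c n u u := by
  induction n generalizing u with
  | zero => rfl
  | succ n ih => exact ⟨ih u, Equiv.refl V, fun y => ⟨Iff.rfl, ih y⟩⟩

theorem RefineEq.symm {n : ℕ} {u : V} {u' : W} (h : RefineEq G H c d n u u') :
    RefineEq H G d c n u' u := by
  induction n generalizing u u' with
  | zero => exact Eq.symm h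
  | succ n ih =>
    obtain ⟨h, f, hf⟩ := h
    refine ⟨ih h, f.symm, fun y => ?_⟩
    obtain ⟨h1, h2⟩ := hf (f.symm y)
    rw [f.apply_symm_apply] at h1 h2
    exact ⟨h1.symm, ih h2⟩

theorem RefineEq.trans {n : ℕ} {u : V} {u' : W} {u'' : U} (h : RefineEq G H c d n u u')
    (h' : RefineEq H K d e n u' u'') : RefineEq G K c e n u u'' := by
  induction n generalizing u u' u'' with
  | zero => exact Eq.trans h h'
  | succ n ih =>
    obtain ⟨h, f, hf⟩ := h
    obtain ⟨h', f', hf'⟩ := h'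
    refine ⟨ih h h', f.trans f', fun y => ?_⟩
    exact ⟨(hf y).1.trans (hf' (f y)).1, ih (hf y).2 (hf' (f y)).2⟩

theorem RefineEq.mono {n m : ℕ} (hnm : n ≤ m) {u : V} {u' : W} (h : RefineEq G H c d m u u') :
    RefineEq G H c d n u u' := by
  induction hnm with
  | refl => exact h
  | step _ ih => exact ih h.1

theorem RefineEq.coarsen {c₂ : V → κ'} {d₂ : W → κ'} (hcd : ∀ x y, c x = d y → c₂ x = d₂ y)
    {n : ℕ} {u : V} {u' : W} (h : RefineEq G H c d n u u') : RefineEq G H c₂ d₂ n u u' := by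
  induction n generalizing u u' with
  | zero => exact hcd _ _ h
  | succ n ih =>
    obtain ⟨h, f, hf⟩ := h
    exact ⟨ih h, f, fun y => ⟨(hf y).1, ih (hf y).2⟩⟩

theorem StableEq.refl (u : V) : StableEq G G c c u u := fun n => RefineEq.refl n u

theorem StableEq.symm {u : V} {u' : W} (h : StableEq G H c d u u') : StableEq H G d c u' u :=
  fun n => (h n).symm

theorem StableEq.trans {u : V} {u' : W} {u'' : U} (h : StableEq G H c d u u')
    (h' : StableEq H K d e u' u'') : StableEq G K c e u u'' :=
  fun n => (h n).trans (h' n)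

theorem StableEq.coarsen {c₂ : V → κ'} {d₂ : W → κ'} (hcd : ∀ x y, c x = d y → c₂ x = d₂ y)
    {u : V} {u' : W} (h : StableEq G H c d u u') : StableEq G H c₂ d₂ u u' :=
  fun n => (h n).coarsen hcd

/-- Each of the finitely many pairs with different stable colours is separated in some round; a
common bound on these rounds works for all pairs. -/
theorem exists_refineEq_stable [Finite V] [Finite W] (G : SimpleGraph V) (H : SimpleGraph W)
    (c : V → κ) (d : W → κ) :
    ∃ n, ∀ u u', RefineEq G H c d n u u' → StableEq G H c d u u' := by
  have : ∀ p : V × W, ∃ n, RefineEq G H c d n p.1 p.2 → StableEq G H c d p.1 p.2 := by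
    intro p
    by_cases h : StableEq G H c d p.1 p.2
    · exact ⟨0, fun _ => h⟩
    · obtain ⟨n, hn⟩ := not_forall.1 h
      exact ⟨n, fun h => absurd h hn⟩
  choose N hN using this
  obtain ⟨n, hn⟩ := (Set.finite_range N).bddAbove
  exact ⟨n, fun u u' h => hN (u, u') (h.mono (hn ⟨(u, u'), rfl⟩))⟩

theorem StableEq.exists_equiv [Finite V] [Finite W] {u : V} {u' : W}
    (h : StableEq G H c d u u') :
    ∃ f : V ≃ W, ∀ y, (G.Adj u y ↔ H.Adj u' (f y)) ∧ StableEq G H c d y (f y) := by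
  obtain ⟨n, hn⟩ := exists_refineEq_stable G H c d
  obtain ⟨-, f, hf⟩ := h (n + 1)
  exact ⟨f, fun y => ⟨(hf y).1, hn _ _ (hf y).2⟩⟩

/-- Equality of stable colours extends from the complement of a set `D` to `D` along a
bijection that preserves the adjacencies of the vertices in `D`. -/
theorem stableEq_of_equiv (Φ : V ≃ W) (D : Set V)
    (hadj : ∀ u ∈ D, ∀ y, (G.Adj u y ↔ H.Adj (Φ u) (Φ y)))
    (hcol : ∀ u ∈ D, c u = d (Φ u)) (hout : ∀ y ∉ D, StableEq G H c d y (Φ y)) (y : V) :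
    StableEq G H c d y (Φ y) := by
  intro n
  induction n generalizing y with
  | zero =>
    by_cases hy : y ∈ D
    · exact hcol y hy
    · exact hout y hy 0
  | succ n ih =>
    by_cases hy : y ∈ D
    · exact ⟨ih y, Φ, fun z => ⟨hadj y hy z, ih z⟩⟩
    · exact hout y hy (n + 1)

/-! ## Flips -/

/-- Adjacency in the graph that arises from `G` by flipping the edges between colour classes as
described by `f`. -/
def FlipAdj {ι : Type*} (G : SimpleGraph V) (l : V → ι) (f : ι → ι → Prop) (u w : V) : Prop :=
  ¬ (G.Adj u w ↔ f (l u) (l w))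

/-- Connectedness in a flipped graph. -/
def FlipConn {ι : Type*} (G : SimpleGraph V) (l : V → ι) (f : ι → ι → Prop) : V → V → Prop :=
  Relation.ReflTransGen (FlipAdj G l f)

theorem FlipAdj.symm {ι : Type*} {l : V → ι} {f : ι → ι → Prop} (hf : ∀ a b, f a b → f b a)
    {u w : V} (h : FlipAdj G l f u w) : FlipAdj G l f w u := by
  unfold FlipAdj at *
  rwa [G.adj_comm, show f (l w) (l u) ↔ f (l u) (l w) from ⟨hf _ _, hf _ _⟩]

theorem FlipConn.symm {ι : Type*} {l : V → ι} {f : ι → ι → Prop} (hf : ∀ a b, f a b → f b a)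
    {u w : V} (h : FlipConn G l f u w) : FlipConn G l f w u :=
  haveI : Std.Symm (FlipAdj G l f) := ⟨fun _ _ => FlipAdj.symm hf⟩
  (Relation.ReflTransGen.stdSymm).symm _ _ h

theorem FlipConn.refl {ι : Type*} {l : V → ι} {f : ι → ι → Prop} (u : V) :
    FlipConn G l f u u := Relation.ReflTransGen.refl

theorem FlipConn.trans {ι : Type*} {l : V → ι} {f : ι → ι → Prop} {u v w : V}
    (h : FlipConn G l f u v) (h' : FlipConn G l f v w) : FlipConn G l f u w :=
  Relation.ReflTransGen.trans h h'

theorem adj_iff_of_not_flipConn {ι : Type*} {l : V → ι} {f : ι → ι → Prop} {u w : V}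
    (h : ¬ FlipConn G l f u w) : G.Adj u w ↔ f (l u) (l w) := by
  by_contra h'
  exact h (Relation.ReflTransGen.single h')

/-- A set is separated by a flip if no edge of the flipped graph leaves it. -/
def Separates {ι : Type*} (G : SimpleGraph V) (l : V → ι) (f : ι → ι → Prop) (X : Set V) :
    Prop :=
  ∀ u ∈ X, ∀ w ∉ X, (G.Adj u w ↔ f (l u) (l w))

theorem Separates.mem_of_flipConn {ι : Type*} {l : V → ι} {f : ι → ι → Prop} {X : Set V}
    (h : Separates G l f X) {u w : V} (hu : u ∈ X) (hc : FlipConn G l f u w) : w ∈ X := by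
  induction hc with
  | refl => exact hu
  | tail _ h' ih => exact by_contra fun hw => h' (h _ ih _ hw)

/-- If a colouring is equitable and the adjacency across a cut is determined by the colours,
then the cut is separated by a flip. -/
theorem exists_separates [Finite V] {ι : Type*} (l : V → ι) (X : Set V)
    (heq : ∀ u u', l u = l u' → ∃ e : V ≃ V, ∀ y, (G.Adj u y ↔ G.Adj u' (e y)) ∧ l (e y) = l y)
    (hX : ∀ u ∈ X, ∀ u' ∈ X, ∀ w ∉ X, ∀ w' ∉ X, l u = l u' → l w = l w' →
      (G.Adj u w ↔ G.Adj u' w')) :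
    ∃ f : ι → ι → Prop, (∀ a b, f a b → f b a) ∧ Separates G l f X := by
  -- Two colours are flipped if they occur at the ends of an edge across the cut, in either order.
  -- Symmetry is what makes the claim nontrivial: the edge may run with the colours interchanged.
  refine ⟨fun a b => ∃ u ∈ X, ∃ w ∉ X, G.Adj u w ∧ (l u = a ∧ l w = b ∨ l u = b ∧ l w = a),
    ?_, ?_⟩
  · rintro a b ⟨u, hu, w, hw, h, h'⟩
    exact ⟨u, hu, w, hw, h, h'.symm⟩
  intro u hu w hw
  constructor
  · intro h
    exact ⟨u, hu, w, hw, h, Or.inl ⟨rfl, rfl⟩⟩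
  rintro ⟨x, hx, y, hy, hxy, ⟨h1, h2⟩ | ⟨h1, h2⟩⟩
  · exact (hX x hx u hu y hy w hw h1 h2).1 hxy
  by_contra hnot
  -- Every cross pair coloured like `(u, w)` is now a non-edge and every cross pair coloured like
  -- `(x, y)` is an edge. So the neighbours of `u` in the colour of `w` lie in `X` and are adjacent
  -- to every `y'` outside `X` in the colour of `u`. Equitability gives `u` and `y'` equally many
  -- such neighbours, whence equality in `key`.
  have hsub : ∀ z, G.Adj u z → l z = l w → z ∈ X := fun z hz hlz =>
    by_contra fun hzX => hnot ((hX u hu u hu z hzX w hw rfl hlz).1 hz)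
  have key : ∀ y' ∉ X, l y' = l u →
      {z | G.Adj u z ∧ l z = l w} = {z | G.Adj y' z ∧ l z = l w} := by
    intro y' hy' hly'
    obtain ⟨e, he⟩ := heq u y' hly'.symm
    have hsup : {z | G.Adj u z ∧ l z = l w} ⊆ {z | G.Adj y' z ∧ l z = l w} := by
      rintro z ⟨hz, hlz⟩
      refine ⟨?_, hlz⟩
      exact ((hX x hx z (hsub z hz hlz) y hy y' hy' (h1.trans hlz.symm)
        (h2.trans hly'.symm)).1 hxy).symm
    have hmaps : ∀ z ∈ {z | G.Adj y' z ∧ l z = l w},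
        e.symm z ∈ {z | G.Adj u z ∧ l z = l w} := by
      rintro z ⟨hz, hlz⟩
      refine ⟨?_, ?_⟩
      · rwa [(he _).1, e.apply_symm_apply]
      · rwa [← (he _).2, e.apply_symm_apply]
    exact Set.eq_of_subset_of_ncard_le hsup
      (Set.ncard_le_ncard_of_injOn e.symm hmaps e.symm.injective.injOn) (Set.toFinite _)
  have hux : x ∈ {z | G.Adj u z ∧ l z = l w} := by
    rw [key y hy h2]
    exact ⟨hxy.symm, h1⟩
  -- As `x` is adjacent to `u`, the vertex `w` has a neighbour `e u` in the colour of `u`; neither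
  -- side of the cut can contain it.
  obtain ⟨e, he⟩ := heq x w h1
  have hwe := (he u).1.1 hux.1.symm
  by_cases heX : e u ∈ X
  · exact hnot ((hX _ heX u hu w hw w hw (he u).2 rfl).1 hwe.symm)
  · have hmem : w ∈ {z | G.Adj (e u) z ∧ l z = l w} := ⟨hwe.symm, rfl⟩
    rw [← key _ heX (he u).2] at hmem
    exact hw (hsub w hmem.1 rfl)

end SimpleGraph

/-! ## Pebble games -/

/-- A family of positions from which Duplicator survives the bijective pebble game with `m`
pebbles on two vertex-coloured graphs. A position is a set of pairs of pebbled vertices. -/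
structure IsPebbleSystem {V W κ : Type*} (G : SimpleGraph V) (H : SimpleGraph W) (c : V → κ)
    (d : W → κ) (m : ℕ) (𝓔 : Set (Set (V × W))) : Prop where
  mono : ∀ S ∈ 𝓔, ∀ S' ⊆ S, S' ∈ 𝓔
  eq_iff : ∀ S ∈ 𝓔, ∀ p ∈ S, ∀ q ∈ S, (p.1 = q.1 ↔ p.2 = q.2)
  adj_iff : ∀ S ∈ 𝓔, ∀ p ∈ S, ∀ q ∈ S, (G.Adj p.1 q.1 ↔ H.Adj p.2 q.2)
  colour_eq : ∀ S ∈ 𝓔, ∀ p ∈ S, c p.1 = d p.2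
  extend : ∀ S ∈ 𝓔, S.ncard < m → ∃ g : V ≃ W, ∀ v, insert (v, g v) S ∈ 𝓔

/-- The colouring `c` refined by the pebbles on the left. -/
def pebbleColourLeft {V W κ : Type*} (c : V → κ) (S : Set (V × W)) (u : V) : κ × Set (V × W) :=
  (c u, {p ∈ S | p.1 = u})

/-- The colouring `d` refined by the pebbles on the right. -/
def pebbleColourRight {V W κ : Type*} (d : W → κ) (S : Set (V × W)) (u : W) :
    κ × Set (V × W) :=
  (d u, {p ∈ S | p.2 = u})

/-- The stable colour of a vertex of the left graph, as a set of vertices of the left graph. -/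
def typeLeft {V W κ : Type*} (G : SimpleGraph V) (c : V → κ) (S : Set (V × W)) (x : V) : Set V :=
  {u | G.StableEq G (pebbleColourLeft c S) (pebbleColourLeft c S) u x}

/-- The stable colour of a vertex of the right graph, as a set of vertices of the left graph. -/
def typeRight {V W κ : Type*} (G : SimpleGraph V) (H : SimpleGraph W) (c : V → κ) (d : W → κ)
    (S : Set (V × W)) (x : W) : Set V :=
  {u | G.StableEq H (pebbleColourLeft c S) (pebbleColourRight d S) u x}

/-- The relations `r` and `r'` correspond to each other in all positions that extend `S` by two
pairs. -/
def InvariantOver {V W : Type*} (𝓔 : Set (Set (V × W))) (S : Set (V × W)) (r : V → V → Prop)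
    (r' : W → W → Prop) : Prop :=
  ∀ u u' w w', insert (u, u') (insert (w, w') S) ∈ 𝓔 → (r u w ↔ r' u' w')

/-! ### Stable colours over pebbled vertices -/

section Types

variable {V W κ : Type*} {G : SimpleGraph V} {H : SimpleGraph W} {c : V → κ} {d : W → κ}
  {S T : Set (V × W)}

theorem mem_typeLeft_self (x : V) : x ∈ typeLeft G c S x := SimpleGraph.StableEq.refl x

theorem typeLeft_eq_iff {x y : V} : typeLeft G c S x = typeLeft G c S y ↔
    G.StableEq G (pebbleColourLeft c S) (pebbleColourLeft c S) x y := by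
  constructor
  · intro h
    have := mem_typeLeft_self (G := G) (c := c) (S := S) x
    rw [h] at this
    exact this
  · intro h
    ext u
    exact ⟨fun hu => SimpleGraph.StableEq.trans hu h,
      fun hu => SimpleGraph.StableEq.trans hu h.symm⟩

theorem typeLeft_eq_typeRight_iff {x : V} {y : W} : typeLeft G c S x = typeRight G H c d S y ↔
    G.StableEq H (pebbleColourLeft c S) (pebbleColourRight d S) x y := by
  constructor
  · intro h
    have := mem_typeLeft_self (G := G) (c := c) (S := S) x
    rw [h] at this
    exact this
  · intro h
    ext u
    exact ⟨fun hu => SimpleGraph.StableEq.trans hu h,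
      fun hu => SimpleGraph.StableEq.trans hu h.symm⟩

theorem typeLeft_eq_mono (hTS : T ⊆ S) {x y : V} (h : typeLeft G c S x = typeLeft G c S y) :
    typeLeft G c T x = typeLeft G c T y := by
  rw [typeLeft_eq_iff] at *
  refine h.coarsen fun a b hab => ?_
  simp only [pebbleColourLeft, Prod.mk.injEq, Set.ext_iff, Set.mem_ofPred_eq] at hab ⊢
  exact ⟨hab.1, fun p => ⟨fun hp => ⟨hp.1, ((hab.2 p).1 ⟨hTS hp.1, hp.2⟩).2⟩,
    fun hp => ⟨hp.1, ((hab.2 p).2 ⟨hTS hp.1, hp.2⟩).2⟩⟩⟩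

theorem typeRight_eq_mono (hTS : T ⊆ S) {x : V} {y : W}
    (h : typeLeft G c S x = typeRight G H c d S y) :
    typeLeft G c T x = typeRight G H c d T y := by
  rw [typeLeft_eq_typeRight_iff] at *
  refine h.coarsen fun a b hab => ?_
  simp only [pebbleColourLeft, pebbleColourRight, Prod.mk.injEq, Set.ext_iff,
    Set.mem_ofPred_eq] at hab ⊢
  exact ⟨hab.1, fun p => ⟨fun hp => ⟨hp.1, ((hab.2 p).1 ⟨hTS hp.1, hp.2⟩).2⟩,
    fun hp => ⟨hp.1, ((hab.2 p).2 ⟨hTS hp.1, hp.2⟩).2⟩⟩⟩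

theorem colour_eq_of_typeLeft_eq_typeRight {x : V} {y : W}
    (h : typeLeft G c S x = typeRight G H c d S y) :
    c x = d y ∧ ∀ p ∈ S, (p.1 = x ↔ p.2 = y) := by
  have h0 := typeLeft_eq_typeRight_iff.1 h 0
  simp only [SimpleGraph.RefineEq, pebbleColourLeft, pebbleColourRight, Prod.mk.injEq,
    Set.ext_iff, Set.mem_ofPred_eq] at h0
  exact ⟨h0.1, fun p hp => ⟨fun h => ((h0.2 p).1 ⟨hp, h⟩).2, fun h => ((h0.2 p).2 ⟨hp, h⟩).2⟩⟩

theorem eq_of_typeLeft_eq {x y : V} {p : V × W} (hp : p ∈ S) (hx : p.1 = x)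
    (h : typeLeft G c S x = typeLeft G c S y) : y = x := by
  have h0 := typeLeft_eq_iff.1 h 0
  simp only [SimpleGraph.RefineEq, pebbleColourLeft, Prod.mk.injEq, Set.ext_iff,
    Set.mem_ofPred_eq] at h0
  exact ((h0.2 p).1 ⟨hp, hx⟩).2.symm.trans hx

variable [Finite V]

theorem typeLeft_equitable {x y : V} (h : typeLeft G c S x = typeLeft G c S y) :
    ∃ e : V ≃ V, ∀ z, (G.Adj x z ↔ G.Adj y (e z)) ∧
      typeLeft G c S (e z) = typeLeft G c S z := by
  obtain ⟨e, he⟩ := (typeLeft_eq_iff.1 h).exists_equiv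
  exact ⟨e, fun z => ⟨(he z).1, (typeLeft_eq_iff.2 (he z).2).symm⟩⟩

theorem adj_pebble_iff {x y : V} {p : V × W} (hp : p ∈ S)
    (h : typeLeft G c S x = typeLeft G c S y) : G.Adj x p.1 ↔ G.Adj y p.1 := by
  obtain ⟨e, he⟩ := typeLeft_equitable h
  rw [(he p.1).1, eq_of_typeLeft_eq hp rfl (he p.1).2.symm]

/-- Vertices of equal stable colour have the same pebbled neighbours, and on a split pair these
determine the adjacencies across the cut. -/
theorem SimpleGraph.IsSplitPair.exists_separates {V : Type*} [Fintype V] {G : SimpleGraph V}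
    {c : V → κ} {S : Set (V × W)} {X A B : Set V}
    (h : G.IsSplitPair X A B) (hS : A ∪ B ⊆ Prod.fst '' S) :
    ∃ f : Set V → Set V → Prop, (∀ a b, f a b → f b a) ∧
      G.Separates (typeLeft G c S) f X := by
  refine SimpleGraph.exists_separates _ _ (fun u u' => typeLeft_equitable) ?_
  intro u hu u' hu' w hw w' hw' huu hww
  rw [h.adj_congr_left hu hu' hw]
  · refine h.adj_congr_right hu' hw hw' fun a ha => ?_
    obtain ⟨p, hp, rfl⟩ := hS (Or.inl ha)
    exact adj_pebble_iff hp hww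
  · intro b hb
    obtain ⟨p, hp, rfl⟩ := hS (Or.inr hb)
    exact adj_pebble_iff hp huu

end Types

/-! ### Relations respected by Duplicator -/

namespace IsPebbleSystem

variable {V W κ : Type*} {G : SimpleGraph V} {H : SimpleGraph W}
  {c : V → κ} {d : W → κ} {m : ℕ} {𝓔 : Set (Set (V × W))} {S T : Set (V × W)}

/-- One spare pebble sits on `u`; Duplicator's bijection for a second one serves as the bijection of
a refinement round, after which the first pebble is lifted. -/
theorem typeLeft_eq_typeRight (hE : IsPebbleSystem G H c d m 𝓔) (hm : S.ncard + 2 ≤ m) {u : V}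
    {u' : W} (h : insert (u, u') S ∈ 𝓔) : typeLeft G c S u = typeRight G H c d S u' := by
  rw [typeLeft_eq_typeRight_iff]
  intro n
  induction n generalizing u u' with
  | zero =>
    have hu : (u, u') ∈ insert (u, u') S := Set.mem_insert _ _
    have h1 := hE.colour_eq _ h _ hu
    simp only [SimpleGraph.RefineEq, pebbleColourLeft, pebbleColourRight, Prod.mk.injEq]
    refine ⟨h1, Set.ext fun p => and_congr_right fun hp => ?_⟩
    exact hE.eq_iff _ h p (Or.inr hp) _ hu
  | succ n ih =>
    have hcard := Set.ncard_insert_le (u, u') S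
    obtain ⟨g, hg⟩ := hE.extend _ h (by omega)
    refine ⟨ih h, g, fun y => ⟨?_, ih (hE.mono _ (hg y) _
      (Set.insert_subset_insert (Set.subset_insert _ _)))⟩⟩
    exact hE.adj_iff _ (hg y) (u, u') (by simp) (y, g y) (by simp)

theorem ncard_eq (hE : IsPebbleSystem G H c d m 𝓔) (h : S ∈ 𝓔) :
    (Prod.fst '' S).ncard = S.ncard := by
  refine Set.InjOn.ncard_image fun p hp q hq hpq => ?_
  exact Prod.ext hpq ((hE.eq_iff _ h p hp q hq).1 hpq)

/-- Pebbles can be placed on any set of vertices of the left graph. -/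
theorem exists_extension [Finite V] [Finite W] (hE : IsPebbleSystem G H c d m 𝓔) (h : S ∈ 𝓔) (A : Set V)
    (hm : (Prod.fst '' S ∪ A).ncard ≤ m) :
    ∃ S' ∈ 𝓔, S ⊆ S' ∧ Prod.fst '' S' = Prod.fst '' S ∪ A := by
  induction A, Set.toFinite A using Set.Finite.induction_on with
  | empty => exact ⟨S, h, subset_rfl, by simp⟩
  | @insert a A haA _ ih =>
    obtain ⟨S', hS', hSS', hf⟩ := ih ((Set.ncard_le_ncard
      (Set.union_subset_union_right _ (Set.subset_insert _ _)) (Set.toFinite _)).trans hm)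
    by_cases ha : a ∈ Prod.fst '' S'
    · refine ⟨S', hS', hSS', ?_⟩
      rw [Set.union_insert, ← hf, Set.insert_eq_of_mem ha]
    · have hlt : S'.ncard < m := by
        rw [Set.union_insert, ← hf, Set.ncard_insert_of_notMem ha, hE.ncard_eq hS'] at hm
        omega
      obtain ⟨g, hg⟩ := hE.extend _ hS' hlt
      refine ⟨_, hg a, hSS'.trans (Set.subset_insert _ _), ?_⟩
      rw [Set.image_insert_eq, hf, Set.union_insert]

theorem invariantOver_flipAdj (hE : IsPebbleSystem G H c d m 𝓔) (hm : S.ncard + 2 ≤ m)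
    (f : Set V → Set V → Prop) : InvariantOver 𝓔 S (G.FlipAdj (typeLeft G c S) f)
      (H.FlipAdj (typeRight G H c d S) f) := by
  intro u u' w w' h
  have h1 := hE.typeLeft_eq_typeRight hm (hE.mono _ h (insert (u, u') S)
    (Set.insert_subset_insert (Set.subset_insert _ _)))
  have h2 := hE.typeLeft_eq_typeRight hm (hE.mono _ h (insert (w, w') S) (Set.subset_insert _ _))
  have h3 := hE.adj_iff _ h (u, u') (by simp) (w, w') (by simp)
  simp only at h3
  unfold SimpleGraph.FlipAdj
  rw [h1, h2, h3]

/-- Two spare pebbles mark the ends of a path. The third is placed on the penultimate vertex, and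
induction on the path applies to its initial part. -/
theorem invariantOver_reflTransGen (hE : IsPebbleSystem G H c d m 𝓔) (hm : S.ncard + 3 ≤ m)
    {r : V → V → Prop} {r' : W → W → Prop} (hr : InvariantOver 𝓔 S r r') :
    InvariantOver 𝓔 S (Relation.ReflTransGen r) (Relation.ReflTransGen r') := by
  have hext : ∀ u u' w w', insert (u, u') (insert (w, w') S) ∈ 𝓔 → ∃ g : V ≃ W, ∀ z,
      insert (u, u') (insert (z, g z) S) ∈ 𝓔 ∧ insert (z, g z) (insert (w, w') S) ∈ 𝓔 := by
    intro u u' w w' h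
    have h1 := Set.ncard_insert_le (u, u') (insert (w, w') S)
    have h2 := Set.ncard_insert_le (w, w') S
    obtain ⟨g, hg⟩ := hE.extend _ h (by omega)
    refine ⟨g, fun z => ⟨hE.mono _ (hg z) _ ?_, hE.mono _ (hg z) _ ?_⟩⟩
    · rintro p (rfl | rfl | hp)
      · simp
      · simp
      · simp [hp]
    · rintro p (rfl | rfl | hp)
      · simp
      · simp
      · simp [hp]
  have heq : ∀ u u' w w', insert (u, u') (insert (w, w') S) ∈ 𝓔 → (u = w ↔ u' = w') :=
    fun u u' w w' h => hE.eq_iff _ h (u, u') (by simp) (w, w') (by simp)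
  intro u u' w w' h
  constructor
  · intro hc
    induction hc generalizing w' with
    | refl =>
      rw [(heq _ _ _ _ h).1 rfl]
    | tail _ hs ih =>
      obtain ⟨g, hg⟩ := hext _ _ _ _ h
      exact (ih _ (hg _).1).tail ((hr _ _ _ _ (hg _).2).1 hs)
  · intro hc
    induction hc generalizing w with
    | refl =>
      rw [(heq _ _ _ _ h).2 rfl]
    | @tail z' _ _ hs ih =>
      obtain ⟨g, hg⟩ := hext _ _ _ _ h
      have hz := hg (g.symm z')
      rw [g.apply_symm_apply] at hz
      exact (ih _ hz.1).tail ((hr _ _ _ _ hz.2).2 hs)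

theorem invariantOver_flipConn (hE : IsPebbleSystem G H c d m 𝓔) (hm : S.ncard + 3 ≤ m)
    (f : Set V → Set V → Prop) : InvariantOver 𝓔 S (G.FlipConn (typeLeft G c S) f)
      (H.FlipConn (typeRight G H c d S) f) :=
  hE.invariantOver_reflTransGen hm (hE.invariantOver_flipAdj (by omega) f)

theorem invariantOver_mono (hE : IsPebbleSystem G H c d m 𝓔) (hTS : T ⊆ S) {r : V → V → Prop}
    {r' : W → W → Prop} (hr : InvariantOver 𝓔 T r r') : InvariantOver 𝓔 S r r' :=
  fun u u' w w' h => hr u u' w w' (hE.mono _ h _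
    (Set.insert_subset_insert (Set.insert_subset_insert hTS)))

/-- A bijection that respects an invariant relation at a pebbled pair of vertices. -/
theorem exists_equiv_of_invariant (hE : IsPebbleSystem G H c d m 𝓔) (hm : S.ncard + 2 ≤ m)
    {v : V} {v' : W} (h : insert (v, v') S ∈ 𝓔) :
    ∃ g : V ≃ W, (∀ y, insert (y, g y) (insert (v, v') S) ∈ 𝓔) ∧ g v = v' ∧
      ∀ r r', InvariantOver 𝓔 S r r' → ∀ y, (r v y ↔ r' v' (g y)) := by
  have h1 := Set.ncard_insert_le (v, v') S
  obtain ⟨g, hg⟩ := hE.extend _ h (by omega)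
  refine ⟨g, hg, ?_, fun r r' hr y => hr _ _ _ _ ?_⟩
  · exact (hE.eq_iff _ (hg v) (v, g v) (by simp) (v, v') (by simp)).1 rfl
  · rw [Set.insert_comm]
    exact hg y

end IsPebbleSystem

/-! ## Matching equivalence classes -/

/-- Weighting each element by the inverse size of its class gives every class total weight one. -/
theorem sum_inv_ncard_class {V : Type*} [Fintype V] (r : Setoid V) (A : Finset (Quotient r))
    [DecidablePred fun w : V => (⟦w⟧ : Quotient r) ∈ A] :
    ∑ w with (⟦w⟧ : Quotient r) ∈ A, ((Set.ncard {y | r w y} : ℚ))⁻¹ = A.card := by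
  classical
  rw [← Finset.sum_fiberwise_of_maps_to (s := {w | (⟦w⟧ : Quotient r) ∈ A}) (t := A)
    (g := fun w => (⟦w⟧ : Quotient r)) (fun w hw => by simpa using hw)]
  rw [Finset.card_eq_sum_ones, Nat.cast_sum]
  refine Finset.sum_congr rfl fun q hq => ?_
  obtain ⟨v, rfl⟩ := Quotient.exists_rep q
  have hfil : ((Finset.univ.filter fun w => (⟦w⟧ : Quotient r) ∈ A).filter
      fun w => (⟦w⟧ : Quotient r) = ⟦v⟧) = Finset.univ.filter fun w => r v w := by
    ext w
    simp only [Finset.mem_filter, Finset.mem_univ, true_and]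
    constructor
    · rintro ⟨-, h⟩
      exact r.symm (Quotient.exact h)
    · intro h
      have h' : (⟦w⟧ : Quotient r) = ⟦v⟧ := Quotient.sound (r.symm h)
      exact ⟨h' ▸ hq, h'⟩
  rw [hfil]
  have hconst : ∀ w ∈ Finset.univ.filter fun w => r v w,
      ((Set.ncard {y | r w y} : ℚ))⁻¹ = ((Finset.univ.filter fun w => r v w).card : ℚ)⁻¹ := by
    intro w hw
    have hw' : r v w := by simpa using hw
    rw [← Set.ncard_coe_finset]
    congr 3
    ext y
    simp only [Set.mem_ofPred_eq, Finset.coe_filter, Finset.mem_univ, true_and]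
    exact ⟨fun h => r.trans hw' h, fun h => r.trans (r.symm hw') h⟩
  rw [Finset.sum_congr rfl hconst, Finset.sum_const, nsmul_eq_mul, mul_inv_cancel₀, Nat.cast_one]
  rw [Nat.cast_ne_zero, Finset.card_ne_zero]
  exact ⟨v, by simp⟩

/-- If a bijection matches elements whose equivalence classes have equal size, then the classes
can be matched along the bijection. -/
theorem exists_equiv_quotient {V W : Type*} [Finite V] [Finite W] (r : Setoid V) (r' : Setoid W)
    (g : V ≃ W) (hg : ∀ w, Set.ncard {y | r w y} = Set.ncard {y | r' (g w) y}) :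
    ∃ σ : Quotient r ≃ Quotient r', ∀ q, ∃ w, ⟦w⟧ = q ∧ ⟦g w⟧ = σ q := by
  classical
  have := Fintype.ofFinite V
  have := Fintype.ofFinite W
  have hle : ∀ (A : Finset (Quotient r)) (B : Finset (Quotient r')),
      (∀ w, ⟦w⟧ ∈ A → ⟦g w⟧ ∈ B) → A.card ≤ B.card := by
    intro A B hAB
    have : (A.card : ℚ) ≤ B.card := by
      rw [← sum_inv_ncard_class r A, ← sum_inv_ncard_class r' B]
      simp only [hg]
      refine (Finset.sum_map _ g.toEmbedding
        (fun y => ((Set.ncard {z | r' y z} : ℚ))⁻¹)).symm.trans_le ?_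
      refine Finset.sum_le_sum_of_subset_of_nonneg ?_ fun y _ _ => by positivity
      intro y hy
      obtain ⟨w, hw, rfl⟩ := Finset.mem_map.1 hy
      simpa using hAB w (by simpa using hw)
    exact_mod_cast this
  let t : Quotient r → Finset (Quotient r') := fun q =>
    Finset.univ.filter fun q' => ∃ w, ⟦w⟧ = q ∧ ⟦g w⟧ = q'
  -- Hall's condition holds because `g` preserves the weights, so a set of classes weighs at most as
  -- much as the set of classes that `g` reaches from it.
  obtain ⟨σ, hσ, hσt⟩ := (Finset.all_card_le_biUnion_card_iff_exists_injective t).1 fun A =>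
    hle A _ fun w hw => Finset.mem_biUnion.2 ⟨_, hw, by
      simp only [t, Finset.mem_filter, Finset.mem_univ, true_and]
      exact ⟨w, rfl, rfl⟩⟩
  have hcard : Fintype.card (Quotient r) = Fintype.card (Quotient r') := by
    apply le_antisymm (Fintype.card_le_of_injective σ hσ)
    have : ((Finset.univ : Finset (Quotient r')).card : ℚ) =
        (Finset.univ : Finset (Quotient r)).card := by
      rw [← sum_inv_ncard_class r, ← sum_inv_ncard_class r']
      simp only [hg, Finset.mem_univ, Finset.filter_true]
      exact (Equiv.sum_comp g (fun y => ((Set.ncard {z | r' y z} : ℚ))⁻¹)).symm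
    exact le_of_eq (by exact_mod_cast this)
  refine ⟨Equiv.ofBijective σ ((Fintype.bijective_iff_injective_and_card σ).2 ⟨hσ, hcard⟩),
    fun q => ?_⟩
  simpa [t] using hσt q

/-! ## Isomorphisms between components of flipped graphs -/

theorem reflTransGen_congr_of_reachable {α : Type*} {r s : α → α → Prop} {a : α}
    (h : ∀ b, Relation.ReflTransGen r a b → ∀ z, (r b z ↔ s b z)) (b : α) :
    Relation.ReflTransGen r a b ↔ Relation.ReflTransGen s a b := by
  constructor
  · intro hr
    induction hr with
    | refl => exact .refl
    | tail hr hs ih => exact ih.tail ((h _ hr _).1 hs)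
  · intro hr
    induction hr with
    | refl => exact .refl
    | tail _ hs ih => exact ih.tail ((h _ ih _).2 hs)

/-- Flips that separate the two parts of a disjoint union, and the union itself, can be combined
to a single flip on a common refinement of the colourings. -/
theorem SimpleGraph.exists_common_flip {V ι ι₀ ι₁ ι₂ : Type*} {G : SimpleGraph V} (l : V → ι)
    {l₀ : V → ι₀} {l₁ : V → ι₁} {l₂ : V → ι₂} {f₀ : ι₀ → ι₀ → Prop} {f₁ : ι₁ → ι₁ → Prop}
    {f₂ : ι₂ → ι₂ → Prop} {X₁ X₂ : Set V} (h₀ : ∀ x y, l x = l y → l₀ x = l₀ y)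
    (h₁ : ∀ x y, l x = l y → l₁ x = l₁ y) (h₂ : ∀ x y, l x = l y → l₂ x = l₂ y)
    (hf₁ : ∀ a b, f₁ a b → f₁ b a) (hf₂ : ∀ a b, f₂ a b → f₂ b a)
    (hs₀ : G.Separates l₀ f₀ (X₁ ∪ X₂)) (hs₁ : G.Separates l₁ f₁ X₁)
    (hs₂ : G.Separates l₂ f₂ X₂) (hd : Disjoint X₁ X₂) :
    ∃ f : ι → ι → Prop, (∀ a b, f a b → f b a) ∧
      (∀ u ∈ X₁, ∀ y, (f (l u) (l y) ↔ f₁ (l₁ u) (l₁ y))) ∧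
      (∀ u ∈ X₂, ∀ y, (f (l u) (l y) ↔ f₂ (l₂ u) (l₂ y))) := by
  let M : ι → Prop := fun a => ∃ x ∈ X₁, l x = a
  let F₁ : ι → ι → Prop := fun a b => ∃ u w, l u = a ∧ l w = b ∧ f₁ (l₁ u) (l₁ w)
  let F₂ : ι → ι → Prop := fun a b => ∃ u w, l u = a ∧ l w = b ∧ f₂ (l₂ u) (l₂ w)
  have hF₁ : ∀ u w, F₁ (l u) (l w) ↔ f₁ (l₁ u) (l₁ w) := fun u w =>
    ⟨fun ⟨x, y, hx, hy, h⟩ => by rwa [← h₁ x u hx, ← h₁ y w hy],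
      fun h => ⟨u, w, rfl, rfl, h⟩⟩
  have hF₂ : ∀ u w, F₂ (l u) (l w) ↔ f₂ (l₂ u) (l₂ w) := fun u w =>
    ⟨fun ⟨x, y, hx, hy, h⟩ => by rwa [← h₂ x u hx, ← h₂ y w hy],
      fun h => ⟨u, w, rfl, rfl, h⟩⟩
  have hsymm₁ : ∀ a b, f₁ a b ↔ f₁ b a := fun a b => ⟨hf₁ a b, hf₁ b a⟩
  have hd₁ : ∀ x ∈ X₁, x ∉ X₂ := fun x hx => hd.notMem_of_mem_left hx
  have hd₂ : ∀ x ∈ X₂, x ∉ X₁ := fun x hx => hd.notMem_of_mem_right hx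
  -- The rule `F₁` is used whenever one of the colours occurs in `X₁`. What remains is that it
  -- agrees with `F₂` at a vertex of `X₂` in such a case.
  refine ⟨fun a b => (M a ∨ M b) ∧ F₁ a b ∨ ¬ (M a ∨ M b) ∧ F₂ a b, ?_, ?_, ?_⟩
  · rintro a b (⟨h, u, w, hu, hw, hf⟩ | ⟨h, u, w, hu, hw, hf⟩)
    · exact Or.inl ⟨h.symm, w, u, hw, hu, hf₁ _ _ hf⟩
    · exact Or.inr ⟨fun h' => h h'.symm, w, u, hw, hu, hf₂ _ _ hf⟩
  · intro u hu y
    have hM : M (l u) := ⟨u, hu, rfl⟩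
    simp only [hM, true_or, not_true, true_and, false_and, or_false, hF₁]
  · intro u hu y
    by_cases hM : M (l u) ∨ M (l y)
    · simp only [hM, not_true, true_and, false_and, or_false, hF₁]
      -- A vertex `x` of `X₁` with the same fine colour replaces `u` or `y`, so that both rules can
      -- be read off as adjacencies across cuts. For `y` outside both parts the comparison goes
      -- through `f₀`.
      rcases hM with ⟨x, hx, hxu⟩ | ⟨x, hx, hxy⟩
      · by_cases hy₁ : y ∈ X₁
        · rw [hsymm₁, ← hs₁ y hy₁ u (hd₂ u hu), ← hs₂ u hu y (hd₁ y hy₁), G.adj_comm]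
        rw [← h₁ _ _ hxu, ← hs₁ x hx y hy₁]
        by_cases hy₂ : y ∈ X₂
        · rw [← h₂ _ _ hxu, G.adj_comm, hs₂ y hy₂ x (hd₁ x hx)]
          exact ⟨hf₂ _ _, hf₂ _ _⟩
        · have hy : y ∉ X₁ ∪ X₂ := fun h => h.elim hy₁ hy₂
          rw [← hs₂ u hu y hy₂, hs₀ x (Or.inl hx) y hy, hs₀ u (Or.inr hu) y hy, h₀ _ _ hxu]
      · rw [← h₁ _ _ hxy, ← h₂ _ _ hxy, hsymm₁, ← hs₁ x hx u (hd₂ u hu),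
          ← hs₂ u hu x (hd₁ x hx), G.adj_comm]
    · simp only [hM, not_false_eq_true, true_and, false_and, false_or, hF₂]

/-- `φ` restricts to an isomorphism from the subgraph induced by `D` to that induced by `D'`,
and it preserves stable colours over the pebbles in `S`. -/
structure IsTypedIso {V W κ : Type*} (G : SimpleGraph V) (H : SimpleGraph W) (c : V → κ)
    (d : W → κ) (S : Set (V × W)) (φ : V → W) (D : Set V) (D' : Set W) : Prop where
  bijOn : Set.BijOn φ D D'
  adj_iff : ∀ u ∈ D, ∀ w ∈ D, (G.Adj u w ↔ H.Adj (φ u) (φ w))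
  type_eq : ∀ u ∈ D, typeLeft G c S u = typeRight G H c d S (φ u)

theorem IsTypedIso.mono {V W κ : Type*} {G : SimpleGraph V} {H : SimpleGraph W} {c : V → κ}
    {d : W → κ} {S T : Set (V × W)} (hTS : T ⊆ S) {φ : V → W} {D : Set V} {D' : Set W}
    (h : IsTypedIso G H c d S φ D D') : IsTypedIso G H c d T φ D D' :=
  ⟨h.bijOn, h.adj_iff, fun u hu => typeRight_eq_mono hTS (h.type_eq u hu)⟩

/-- A map that is bijective from `D` to `D'` can be combined with a bijection that maps `D`
to `D'`. -/
theorem exists_equiv_piecewise {V W : Type*} {φ : V → W} {D : Set V} {D' : Set W}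
    (hφ : Set.BijOn φ D D') (g : V ≃ W) (hg : ∀ y, y ∈ D ↔ g y ∈ D') :
    ∃ Φ : V ≃ W, (∀ y ∈ D, Φ y = φ y) ∧ ∀ y ∉ D, Φ y = g y := by
  classical
  have hin : ∀ y ∈ D, D.piecewise φ g y = φ y := fun y hy => Set.piecewise_eq_of_mem _ _ _ hy
  have hout : ∀ y ∉ D, D.piecewise φ g y = g y := fun y hy =>
    Set.piecewise_eq_of_notMem _ _ _ hy
  have hbij : Function.Bijective (D.piecewise φ g) := by
    constructor
    · intro x y hxy
      by_cases hx : x ∈ D <;> by_cases hy : y ∈ D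
      · rw [hin x hx, hin y hy] at hxy
        exact hφ.injOn hx hy hxy
      · rw [hin x hx, hout y hy] at hxy
        exact absurd ((hg y).2 (hxy ▸ hφ.mapsTo hx)) hy
      · rw [hout x hx, hin y hy] at hxy
        exact absurd ((hg x).2 (hxy ▸ hφ.mapsTo hy)) hx
      · rw [hout x hx, hout y hy] at hxy
        exact g.injective hxy
    · intro y
      by_cases hy : y ∈ D'
      · obtain ⟨x, hx, rfl⟩ := hφ.surjOn hy
        exact ⟨x, hin x hx⟩
      · refine ⟨g.symm y, ?_⟩
        rw [hout _ fun h => hy (by simpa using (hg _).1 h), g.apply_symm_apply]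
  exact ⟨Equiv.ofBijective _ hbij, hin, hout⟩

/-! ### Restricting and gluing isomorphisms of components -/

namespace IsPebbleSystem

open SimpleGraph

variable {V W κ : Type*} [Finite V] [Finite W] {G : SimpleGraph V} {H : SimpleGraph W}
  {c : V → κ} {d : W → κ} {m : ℕ} {𝓔 : Set (Set (V × W))} {P Q R : Set (V × W)}

/-- An isomorphism between components relative to the pebbles in `R` also preserves the stable
colours over a larger set `P` of pebbles, and restricts to the intersections with the components
relative to any subset `Q` of `P`, provided that the additional pebbles lie outside a set that is
separated by the flip. -/
theorem restrict_typedIso (hE : IsPebbleSystem G H c d m 𝓔) (hm : P.ncard + 3 ≤ m)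
    (hQP : Q ⊆ P) (hRP : R ⊆ P) {f fP fR : Set V → Set V → Prop}
    {X : Set V} (hpeb : ∀ p ∈ P, p.1 ∈ X → p ∈ R) (hsep : G.Separates (typeLeft G c R) fR X)
    (hfP : ∀ u ∈ X, ∀ y, (fP (typeLeft G c P u) (typeLeft G c P y) ↔
      fR (typeLeft G c R u) (typeLeft G c R y)))
    {w : V} (hw : w ∈ X) {w' : W} (h : insert (w, w') P ∈ 𝓔) {φ : V → W}
    (hφ : IsTypedIso G H c d R φ {y | G.FlipConn (typeLeft G c R) fR w y}
      {y | H.FlipConn (typeRight G H c d R) fR w' y}) (hφw : φ w = w') :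
    IsTypedIso G H c d P φ
      {y | G.FlipConn (typeLeft G c Q) f w y ∧ G.FlipConn (typeLeft G c P) fP w y}
      {y | H.FlipConn (typeRight G H c d Q) f w' y ∧
        H.FlipConn (typeRight G H c d P) fP w' y} := by
  obtain ⟨g, hg, -, hinv⟩ := hE.exists_equiv_of_invariant (by omega) h
  have hncard : ∀ T ⊆ P, T.ncard + 3 ≤ m := fun T hT =>
    (Nat.add_le_add_right (Set.ncard_le_ncard hT (Set.toFinite _)) 3).trans hm
  have hgP : ∀ T ⊆ P, ∀ y, typeLeft G c T y = typeRight G H c d T (g y) := fun T hT y =>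
    typeRight_eq_mono hT (hE.typeLeft_eq_typeRight (by omega) (hE.mono _ (hg y) _
      (Set.insert_subset_insert (Set.subset_insert _ _))))
  have hinvR : ∀ y, G.FlipConn (typeLeft G c R) fR w y ↔
      H.FlipConn (typeRight G H c d R) fR w' (g y) :=
    hinv _ _ (hE.invariantOver_mono hRP (hE.invariantOver_flipConn (hncard R hRP) fR))
  have hinvQ : ∀ y, G.FlipConn (typeLeft G c Q) f w y ↔
      H.FlipConn (typeRight G H c d Q) f w' (g y) :=
    hinv _ _ (hE.invariantOver_mono hQP (hE.invariantOver_flipConn (hncard Q hQP) f))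
  have hDX : ∀ y, G.FlipConn (typeLeft G c R) fR w y → y ∈ X := fun y hy =>
    hsep.mem_of_flipConn hw hy
  -- The component over `R` stays inside `X`, where both flips coincide, so it is also the component
  -- over `P`.
  have hleft : ∀ y, G.FlipConn (typeLeft G c R) fR w y ↔ G.FlipConn (typeLeft G c P) fP w y :=
    reflTransGen_congr_of_reachable fun y hy z => by
      unfold FlipAdj
      rw [hfP y (hDX y hy) z]
  have hright : ∀ y, H.FlipConn (typeRight G H c d R) fR w' y ↔
      H.FlipConn (typeRight G H c d P) fP w' y :=
    reflTransGen_congr_of_reachable fun y' hy' z' => by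
      obtain ⟨y, rfl⟩ := g.surjective y'
      obtain ⟨z, rfl⟩ := g.surjective z'
      unfold FlipAdj
      rw [← hgP P subset_rfl, ← hgP P subset_rfl, hfP y (hDX y ((hinvR y).2 hy')) z,
        hgP R hRP, hgP R hRP]
  -- The isomorphism is used on the component and Duplicator's bijection elsewhere. Adjacencies
  -- leaving the component are determined by colours over `R`, which both maps preserve.
  obtain ⟨Φ, hΦin, hΦout⟩ := exists_equiv_piecewise hφ.bijOn g hinvR
  have hΦw : Φ w = w' := (hΦin w (FlipConn.refl w)).trans hφw
  have hadj : ∀ u, G.FlipConn (typeLeft G c R) fR w u → ∀ y,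
      (G.Adj u y ↔ H.Adj (Φ u) (Φ y)) := by
    intro u hu y
    rw [hΦin u hu]
    by_cases hy : G.FlipConn (typeLeft G c R) fR w y
    · rw [hΦin y hy]
      exact hφ.adj_iff u hu y hy
    · rw [hΦout y hy, adj_iff_of_not_flipConn fun h' => hy (hu.trans h'),
        adj_iff_of_not_flipConn fun h' => hy ((hinvR y).2 ((hφ.bijOn.mapsTo hu).trans h')),
        hφ.type_eq u hu, hgP R hRP]
  have hcol : ∀ u ∈ {y | G.FlipConn (typeLeft G c R) fR w y},
      pebbleColourLeft c P u = pebbleColourRight d P (Φ u) := by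
    intro u hu
    obtain ⟨h1, h2⟩ := colour_eq_of_typeLeft_eq_typeRight (hφ.type_eq u hu)
    rw [← hΦin u hu] at h1 h2
    refine Prod.ext h1 (Set.ext fun p => and_congr_right fun hp => ⟨fun hpu => ?_, fun hpu => ?_⟩)
    · exact (h2 p (hpeb p hp (hpu ▸ hDX u hu))).1 hpu
    · by_cases hy : G.FlipConn (typeLeft G c R) fR w p.1
      · exact (h2 p (hpeb p hp (hDX _ hy))).2 hpu
      · have hgp : g p.1 = p.2 := (hE.eq_iff _ (hg p.1) (p.1, g p.1) (by simp) p
          (by simp [hp])).1 rfl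
        exact Φ.injective ((hΦout _ hy).trans (hgp.trans hpu))
  -- Outside the component the colours over `P` already agree; inside it, `Φ` itself serves as the
  -- bijection in every round of refinement.
  have htype : ∀ y, typeLeft G c P y = typeRight G H c d P (Φ y) := fun y =>
    typeLeft_eq_typeRight_iff.2 (stableEq_of_equiv Φ _ hadj hcol (fun y hy => by
      rw [hΦout y hy]
      exact typeLeft_eq_typeRight_iff.1 (hgP P subset_rfl y)) y)
  have hflip : ∀ u, G.FlipConn (typeLeft G c R) fR w u → ∀ y,
      (G.FlipAdj (typeLeft G c Q) f y u ↔
        H.FlipAdj (typeRight G H c d Q) f (Φ y) (Φ u)) := by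
    intro u hu y
    unfold FlipAdj
    rw [typeRight_eq_mono hQP (htype u), typeRight_eq_mono hQP (htype y), G.adj_comm,
      hadj u hu y, H.adj_comm]
  -- Induction on the path: a last step ending in the component is transported by `Φ`, and for an
  -- endpoint outside it `Φ` agrees with `g`, whose invariance already gives the claim.
  have hQ : ∀ y, G.FlipConn (typeLeft G c Q) f w y ↔
      H.FlipConn (typeRight G H c d Q) f w' (Φ y) := by
    intro y
    constructor
    · intro hy
      induction hy with
      | refl => rw [hΦw]; exact FlipConn.refl _
      | @tail z y hz hs ih =>
        by_cases hy : G.FlipConn (typeLeft G c R) fR w y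
        · exact Relation.ReflTransGen.tail ih ((hflip y hy z).1 hs)
        · rw [hΦout y hy]
          exact (hinvQ y).1 (Relation.ReflTransGen.tail hz hs)
    · obtain ⟨y', rfl⟩ := Φ.symm.surjective y
      rw [Φ.apply_symm_apply]
      intro hy
      induction hy with
      | refl => rw [← hΦw, Φ.symm_apply_apply]; exact FlipConn.refl _
      | @tail z y hz hs ih =>
        obtain ⟨y, rfl⟩ := Φ.surjective y
        obtain ⟨z, rfl⟩ := Φ.surjective z
        rw [Φ.symm_apply_apply] at ih ⊢
        by_cases hy : G.FlipConn (typeLeft G c R) fR w y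
        · exact Relation.ReflTransGen.tail ih ((hflip y hy z).2 hs)
        · refine (hinvQ y).2 ?_
          rw [← hΦout y hy]
          exact Relation.ReflTransGen.tail hz hs
  simp only [← hleft, ← hright]
  refine ⟨⟨?_, ?_, ?_⟩, ?_, ?_⟩
  · rintro y ⟨h1, h2⟩
    refine ⟨?_, hφ.bijOn.mapsTo h2⟩
    rw [← hΦin y h2]
    exact (hQ y).1 h1
  · exact hφ.bijOn.injOn.mono fun y hy => hy.2
  · rintro y ⟨h1, h2⟩
    obtain ⟨x, hx, rfl⟩ := hφ.bijOn.surjOn h2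
    rw [← hΦin x hx] at h1
    exact ⟨x, ⟨(hQ x).2 h1, hx⟩, rfl⟩
  · exact fun u hu y hy => hφ.adj_iff u hu.2 y hy.2
  · intro u hu
    rw [← hΦin u hu.2]
    exact htype u

/-- Isomorphisms between the pieces into which a finer flip divides a component can be glued to
an isomorphism between components. -/
theorem glue_typedIso (hE : IsPebbleSystem G H c d m 𝓔) (hm : P.ncard + 3 ≤ m) (hQP : Q ⊆ P)
    {f fP : Set V → Set V → Prop} (hf : ∀ a b, f a b → f b a) (hfP : ∀ a b, fP a b → fP b a)
    {v : V} {v' : W} (hv : insert (v, v') P ∈ 𝓔)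
    (hpieces : ∀ w w', G.FlipConn (typeLeft G c Q) f v w → insert (w, w') P ∈ 𝓔 →
      ∃ φ, IsTypedIso G H c d P φ
        {y | G.FlipConn (typeLeft G c Q) f w y ∧ G.FlipConn (typeLeft G c P) fP w y}
        {y | H.FlipConn (typeRight G H c d Q) f w' y ∧
          H.FlipConn (typeRight G H c d P) fP w' y} ∧ φ w = w') :
    ∃ φ, IsTypedIso G H c d P φ {y | G.FlipConn (typeLeft G c Q) f v y}
      {y | H.FlipConn (typeRight G H c d Q) f v' y} ∧ φ v = v' := by
  let r : Setoid V := ⟨fun w y => G.FlipConn (typeLeft G c Q) f w y ∧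
      G.FlipConn (typeLeft G c P) fP w y, fun x => ⟨.refl x, .refl x⟩,
    fun h => ⟨h.1.symm hf, h.2.symm hfP⟩, fun h h' => ⟨h.1.trans h'.1, h.2.trans h'.2⟩⟩
  let r' : Setoid W := ⟨fun w y => H.FlipConn (typeRight G H c d Q) f w y ∧
      H.FlipConn (typeRight G H c d P) fP w y, fun x => ⟨.refl x, .refl x⟩,
    fun h => ⟨h.1.symm hf, h.2.symm hfP⟩, fun h h' => ⟨h.1.trans h'.1, h.2.trans h'.2⟩⟩
  have hQm : Q.ncard + 3 ≤ m :=
    (Nat.add_le_add_right (Set.ncard_le_ncard hQP (Set.toFinite _)) 3).trans hm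
  have hinvQ := hE.invariantOver_mono hQP (hE.invariantOver_flipConn hQm f)
  have hinvr : InvariantOver 𝓔 P r r' := fun u u' w w' h =>
    and_congr (hinvQ u u' w w' h) (hE.invariantOver_flipConn hm fP u u' w w' h)
  obtain ⟨g, hg, hgv, hginv⟩ := hE.exists_equiv_of_invariant (by omega) hv
  have hgP : ∀ y, insert (y, g y) P ∈ 𝓔 := fun y =>
    hE.mono _ (hg y) _ (Set.insert_subset_insert (Set.subset_insert _ _))
  -- With `w` and `g w` pebbled, Duplicator's next bijection maps the class of `w` onto that of `g
  -- w`.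
  have hcard : ∀ w, Set.ncard {y | r w y} = Set.ncard {y | r' (g w) y} := by
    intro w
    obtain ⟨e, -, -, he⟩ := hE.exists_equiv_of_invariant (by omega) (hgP w)
    rw [← Set.ncard_image_of_injective _ e.injective]
    congr 1
    ext y'
    obtain ⟨y, rfl⟩ := e.surjective y'
    rw [e.injective.mem_set_image]
    exact he r r' hinvr y
  obtain ⟨σ, hσ⟩ := exists_equiv_quotient r r' g hcard
  -- The class of `v` gets the representatives `v` and `v'`, so that the glued map sends `v` to
  -- `v'`.
  have hrep : ∀ q : Quotient r, ∃ w w', (⟦w⟧ : Quotient r) = q ∧ ⟦w'⟧ = σ q ∧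
      insert (w, w') P ∈ 𝓔 ∧ (⟦v⟧ = q → w = v ∧ w' = v') := by
    intro q
    obtain ⟨w, hw, hw'⟩ := hσ q
    by_cases hq : ⟦v⟧ = q
    · refine ⟨v, v', hq, ?_, hv, fun _ => ⟨rfl, rfl⟩⟩
      rw [← hw']
      exact Quotient.sound ((hginv r r' hinvr w).1 (Quotient.exact (hq.trans hw.symm)))
    · exact ⟨w, g w, hw, hw', hgP w, fun h => absurd h hq⟩
  choose p p' hp hp' hpE hpv using hrep
  have hmem : ∀ q, G.FlipConn (typeLeft G c Q) f v (p q) ↔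
      H.FlipConn (typeRight G H c d Q) f v' (p' q) := by
    intro q
    obtain ⟨w, hw, hw'⟩ := hσ q
    have h1 : r w (p q) := Quotient.exact (hw.trans (hp q).symm)
    have h2 : r' (g w) (p' q) := Quotient.exact (hw'.trans (hp' q).symm)
    have h3 := hginv _ _ hinvQ w
    exact ⟨fun h => (h3.1 (h.trans (h1.1.symm hf))).trans h2.1,
      fun h => (h3.2 (h.trans (h2.1.symm hf))).trans h1.1⟩
  have hφ : ∀ q, ∃ φ : V → W, G.FlipConn (typeLeft G c Q) f v (p q) →
      IsTypedIso G H c d P φ {y | r (p q) y} {y | r' (p' q) y} ∧ φ (p q) = p' q := by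
    intro q
    by_cases h : G.FlipConn (typeLeft G c Q) f v (p q)
    · obtain ⟨φ, hφ⟩ := hpieces _ _ h (hpE q)
      exact ⟨φ, fun _ => hφ⟩
    · exact ⟨g, fun h' => absurd h' h⟩
  choose φ hφ using hφ
  have hpu : ∀ u : V, r (p ⟦u⟧) u := fun u => Quotient.exact (hp ⟦u⟧)
  have hiso : ∀ u, G.FlipConn (typeLeft G c Q) f v u → G.FlipConn (typeLeft G c Q) f v (p ⟦u⟧) :=
    fun u hu => hu.trans ((hpu u).1.symm hf)
  have hclass : ∀ u, G.FlipConn (typeLeft G c Q) f v u → r' (p' ⟦u⟧) (φ ⟦u⟧ u) := fun u hu =>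
    (hφ _ (hiso u hu)).1.bijOn.mapsTo (hpu u)
  have hσu : ∀ u, G.FlipConn (typeLeft G c Q) f v u →
      (⟦φ ⟦u⟧ u⟧ : Quotient r') = σ ⟦u⟧ := fun u hu => by
    rw [← hp']
    exact Quotient.sound (r'.symm (hclass u hu))
  refine ⟨fun u => φ ⟦u⟧ u, ⟨⟨?_, ?_, ?_⟩, ?_, ?_⟩, ?_⟩
  · intro u hu
    exact ((hmem _).1 (hiso u hu)).trans (hclass u hu).1
  · intro u hu w hw huw
    have hq : (⟦u⟧ : Quotient r) = ⟦w⟧ := by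
      apply σ.injective
      rw [← hσu u hu, ← hσu w hw]
      exact congrArg _ huw
    simp only [hq] at huw
    refine (hφ _ (hiso w hw)).1.bijOn.injOn ?_ (hpu w) huw
    rw [← hq]
    exact hpu u
  · intro y hy
    have hy' : r' (p' (σ.symm ⟦y⟧)) y := Quotient.exact (by rw [hp', σ.apply_symm_apply])
    have hc : G.FlipConn (typeLeft G c Q) f v (p (σ.symm ⟦y⟧)) :=
      (hmem _).2 (FlipConn.trans hy (hy'.1.symm hf))
    obtain ⟨u, hu, huy⟩ := (hφ _ hc).1.bijOn.surjOn hy'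
    have hq : (⟦u⟧ : Quotient r) = σ.symm ⟦y⟧ := by
      rw [← hp (σ.symm ⟦y⟧)]
      exact Quotient.sound (r.symm hu)
    refine ⟨u, hc.trans hu.1, ?_⟩
    simp only [hq]
    exact huy
  · intro u hu w hw
    by_cases hq : (⟦u⟧ : Quotient r) = ⟦w⟧
    · simp only [hq]
      refine (hφ _ (hiso w hw)).1.adj_iff u ?_ w (hpu w)
      rw [← hq]
      exact hpu u
    -- Different pieces of one component are disconnected in the finer flip, so adjacency between
    -- them is a function of the preserved colours over `P`.
    · have h1 : ¬ G.FlipConn (typeLeft G c P) fP u w := fun h =>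
        hq (Quotient.sound ⟨(FlipConn.symm hf hu).trans hw, h⟩)
      have h2 : ¬ H.FlipConn (typeRight G H c d P) fP (φ ⟦u⟧ u) (φ ⟦w⟧ w) := fun h => by
        refine hq (σ.injective ?_)
        rw [← hσu u hu, ← hσu w hw]
        refine Quotient.sound ⟨?_, h⟩
        have h3 := ((hmem _).1 (hiso u hu)).trans (hclass u hu).1
        have h4 := ((hmem _).1 (hiso w hw)).trans (hclass w hw).1
        exact (h3.symm hf).trans h4
      rw [adj_iff_of_not_flipConn h1, adj_iff_of_not_flipConn h2,
        (hφ _ (hiso u hu)).1.type_eq u (hpu u), (hφ _ (hiso w hw)).1.type_eq w (hpu w)]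
  · intro u hu
    exact (hφ _ (hiso u hu)).1.type_eq u (hpu u)
  · obtain ⟨h1, h2⟩ := hpv ⟦v⟧ rfl
    have := (hφ _ (hiso v (FlipConn.refl v))).2
    rwa [h1, h2] at this

end IsPebbleSystem

/-! ## Rank decompositions and pebble games -/

namespace IsPebbleSystem

open SimpleGraph

variable {V W κ : Type*} {G : SimpleGraph V} {H : SimpleGraph W}
  {c : V → κ} {d : W → κ} {m : ℕ} {𝓔 : Set (Set (V × W))}

/-- The base case: the component of `v` is trivial, and invariance of connectedness makes that of
`v'` trivial too. -/
theorem exists_typedIso_singleton [Finite V] [Finite W] (hE : IsPebbleSystem G H c d m 𝓔)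
    {Q : Set (V × W)}
    (hm : Q.ncard + 3 ≤ m) {f : Set V → Set V → Prop} {v : V}
    (hsep : G.Separates (typeLeft G c Q) f {v}) {v' : W} (hv : insert (v, v') Q ∈ 𝓔) :
    ∃ φ, IsTypedIso G H c d Q φ {y | G.FlipConn (typeLeft G c Q) f v y}
      {y | H.FlipConn (typeRight G H c d Q) f v' y} ∧ φ v = v' := by
  obtain ⟨g, -, hgv, hginv⟩ := hE.exists_equiv_of_invariant (by omega) hv
  have h1 : {y | G.FlipConn (typeLeft G c Q) f v y} = {v} := by
    ext y
    exact ⟨fun hy => hsep.mem_of_flipConn rfl hy, fun hy => hy ▸ FlipConn.refl _⟩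
  have h2 : {y | H.FlipConn (typeRight G H c d Q) f v' y} = {v'} := by
    ext y
    refine ⟨fun hy => ?_, fun hy => hy ▸ FlipConn.refl _⟩
    obtain ⟨y, rfl⟩ := g.surjective y
    have hy' := (hginv _ _ (hE.invariantOver_flipConn hm f) y).2 hy
    have hyv : y = v := hsep.mem_of_flipConn rfl hy'
    rw [hyv]
    exact hgv
  rw [h1, h2]
  refine ⟨fun _ => v', ⟨⟨?_, ?_, ?_⟩, ?_, ?_⟩, rfl⟩
  · exact fun _ _ => rfl
  · exact Set.injOn_singleton _ _
  · rintro _ rfl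
    exact ⟨v, rfl, rfl⟩
  · rintro _ rfl _ rfl
    simp
  · rintro _ rfl
    exact hE.typeLeft_eq_typeRight (by omega) hv

/-- If the pebbles lie on a split pair at a node of a rank decomposition, and a flip separates
the set at this node, then the components of the flipped graphs that contain an additional
pebbled pair are isomorphic. -/
theorem exists_typedIso [Fintype V] [Finite W] (hE : IsPebbleSystem G H c d m 𝓔) {k : ℕ}
    (hm : 3 * k + 3 ≤ m)
    (T : SetTree V) (hT : T.Valid) (hw : T.width G ≤ k) {A B : Set V}
    (hAB : G.IsSplitPair T.root A B) {Q : Set (V × W)} (hQ : Q ∈ 𝓔)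
    (hQAB : Prod.fst '' Q = A ∪ B) {f : Set V → Set V → Prop} (hf : ∀ a b, f a b → f b a)
    (hsep : G.Separates (typeLeft G c Q) f T.root) {v : V} (hvT : v ∈ T.root) {v' : W}
    (hv : insert (v, v') Q ∈ 𝓔) :
    ∃ φ, IsTypedIso G H c d Q φ {y | G.FlipConn (typeLeft G c Q) f v y}
      {y | H.FlipConn (typeRight G H c d Q) f v' y} ∧ φ v = v' := by
  induction T generalizing A B Q f v v' with
  | leaf X =>
    obtain ⟨x, rfl⟩ := Set.ncard_eq_one.1 hT
    obtain rfl : v = x := hvT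
    refine hE.exists_typedIso_singleton ?_ hsep hv
    have h1 := hE.ncard_eq hQ
    have h2 := Set.ncard_union_le A B
    have h3 := hAB.left_card
    have h4 := hAB.right_card
    rw [hQAB] at h1
    simp only [SetTree.width, SetTree.root] at *
    omega
  | node X l₁ l₂ ih₁ ih₂ =>
    obtain ⟨rfl, hdis, hl₁, hl₂⟩ := hT
    change G.IsSplitPair (l₁.root ∪ l₂.root) A B at hAB
    change G.Separates _ f (l₁.root ∪ l₂.root) at hsep
    change v ∈ l₁.root ∪ l₂.root at hvT
    simp only [SetTree.width, max_le_iff] at hw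
    obtain ⟨hw₀, hw₁, hw₂⟩ := hw
    have hd : Disjoint l₁.root l₂.root := Set.disjoint_iff_inter_eq_empty.2 hdis
    have hroot : ∀ T : SetTree V, T.width G ≤ k → G.cutRank T.root ≤ k := by
      rintro (X | ⟨X, l, r⟩) h
      · exact h
      · exact (le_max_left _ _).trans h
    obtain ⟨A₁, A₂, B₁, B₂, hAB₁, hAB₂, hA, hB₁, hB₂⟩ := hAB.exists_children hd
    -- This is the source of the coefficient three; `B₁` and `B₂` cost nothing extra, being chosen
    -- inside this set.
    have hcard : (A₁ ∪ A₂ ∪ B).ncard ≤ 3 * k := by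
      have h1 := Set.ncard_union_le (A₁ ∪ A₂) B
      have h2 := Set.ncard_union_le A₁ A₂
      have h3 := hAB₁.left_card.trans (hroot _ hw₁)
      have h4 := hAB₂.left_card.trans (hroot _ hw₂)
      have h5 := hAB.right_card.trans hw₀
      omega
    have hABsub : A ∪ B ⊆ A₁ ∪ A₂ ∪ B := Set.union_subset_union_left _ hA
    -- The pair `(v, v')` stays on the board while the other pebbles are placed, so that the answers
    -- are compatible with it.
    obtain ⟨P', hP', hsub, hfst⟩ := hE.exists_extension hv (A₁ ∪ A₂ ∪ B) (by
      rw [Set.image_insert_eq, hQAB, Set.insert_union, Set.union_eq_self_of_subset_left hABsub]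
      exact (Set.ncard_insert_le v (A₁ ∪ A₂ ∪ B)).trans (by omega))
    let above : Set V → Set (V × W) := fun Z => {p ∈ P' | p.1 ∈ Z}
    have habove : ∀ Z ⊆ A₁ ∪ A₂ ∪ B, Prod.fst '' above Z = Z := by
      intro Z hZ
      ext z
      constructor
      · rintro ⟨p, hp, rfl⟩
        exact hp.2
      · intro hz
        obtain ⟨p, hp, rfl⟩ : z ∈ Prod.fst '' P' := by
          rw [hfst]
          exact Or.inr (hZ hz)
        exact ⟨p, ⟨hp, hz⟩, rfl⟩
    have habovemem : ∀ Z, above Z ∈ 𝓔 := fun Z => hE.mono _ hP' _ fun p hp => hp.1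
    have habovemono : ∀ Z ⊆ A₁ ∪ A₂ ∪ B, above Z ⊆ above (A₁ ∪ A₂ ∪ B) :=
      fun Z hZ p hp => ⟨hp.1, hZ hp.2⟩
    have hQP : Q ⊆ above (A₁ ∪ A₂ ∪ B) := fun p hp =>
      ⟨hsub (Or.inr hp), hABsub (hQAB ▸ Set.mem_image_of_mem _ hp)⟩
    have hvP : insert (v, v') (above (A₁ ∪ A₂ ∪ B)) ∈ 𝓔 :=
      hE.mono _ hP' _ (Set.insert_subset (hsub (Or.inl rfl)) fun p hp => hp.1)
    have hPm : (above (A₁ ∪ A₂ ∪ B)).ncard + 3 ≤ m := by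
      rw [← hE.ncard_eq (habovemem _), habove _ subset_rfl]
      omega
    have hs₁ : A₁ ∪ B₁ ⊆ A₁ ∪ A₂ ∪ B := Set.union_subset
      (Set.subset_union_left.trans Set.subset_union_left)
      (hB₁.trans (Set.union_subset_union_left _ Set.subset_union_right))
    have hs₂ : A₂ ∪ B₂ ⊆ A₁ ∪ A₂ ∪ B := Set.union_subset
      (Set.subset_union_right.trans Set.subset_union_left)
      (hB₂.trans (Set.union_subset_union_left _ Set.subset_union_left))
    obtain ⟨f₁, hf₁, hsep₁⟩ := hAB₁.exists_separates (c := c) (habove _ hs₁).ge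
    obtain ⟨f₂, hf₂, hsep₂⟩ := hAB₂.exists_separates (c := c) (habove _ hs₂).ge
    obtain ⟨fP, hfP, hfP₁, hfP₂⟩ := SimpleGraph.exists_common_flip
      (typeLeft G c (above (A₁ ∪ A₂ ∪ B)))
      (fun _ _ => typeLeft_eq_mono hQP) (fun _ _ => typeLeft_eq_mono (habovemono _ hs₁))
      (fun _ _ => typeLeft_eq_mono (habovemono _ hs₂)) hf₁ hf₂ hsep hsep₁ hsep₂ hd
    -- `A₂` lies in the other part and `B` outside the union, so only pebbles on `A₁` can be in this
    -- part.
    have hpeb₁ : ∀ p ∈ above (A₁ ∪ A₂ ∪ B), p.1 ∈ l₁.root → p ∈ above (A₁ ∪ B₁) := by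
      rintro p ⟨hp, (hp1 | hp1) | hp1⟩ hpX
      · exact ⟨hp, Or.inl hp1⟩
      · exact absurd hpX (hd.notMem_of_mem_right (hAB₂.left_subset hp1))
      · exact absurd (Or.inl hpX) (hAB.right_subset hp1)
    have hpeb₂ : ∀ p ∈ above (A₁ ∪ A₂ ∪ B), p.1 ∈ l₂.root → p ∈ above (A₂ ∪ B₂) := by
      rintro p ⟨hp, (hp1 | hp1) | hp1⟩ hpX
      · exact absurd hpX (hd.notMem_of_mem_left (hAB₁.left_subset hp1))
      · exact ⟨hp, Or.inl hp1⟩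
      · exact absurd (Or.inr hpX) (hAB.right_subset hp1)
    obtain ⟨φ, hφ, hφv⟩ := hE.glue_typedIso hPm hQP hf hfP hvP (by
      intro w w' hvw hww
      rcases hsep.mem_of_flipConn hvT hvw with hwX | hwX
      · obtain ⟨φ, hφ, hφw⟩ := ih₁ hl₁ hw₁ hAB₁ (habovemem _) (habove _ hs₁) hf₁ hsep₁ hwX
          (hE.mono _ hww _ (Set.insert_subset_insert (habovemono _ hs₁)))
        exact ⟨φ, hE.restrict_typedIso hPm hQP (habovemono _ hs₁) hpeb₁ hsep₁ hfP₁ hwX hww hφ hφw,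
          hφw⟩
      · obtain ⟨φ, hφ, hφw⟩ := ih₂ hl₂ hw₂ hAB₂ (habovemem _) (habove _ hs₂) hf₂ hsep₂ hwX
          (hE.mono _ hww _ (Set.insert_subset_insert (habovemono _ hs₂)))
        exact ⟨φ, hE.restrict_typedIso hPm hQP (habovemono _ hs₂) hpeb₂ hsep₂ hfP₂ hwX hww hφ hφw,
          hφw⟩)
    exact ⟨φ, hφ.mono hQP, hφv⟩

end IsPebbleSystem

/-- Every nonempty finite set is the root of a valid tree. -/
theorem SetTree.exists_valid {V : Type*} [Finite V] (X : Set V) (hX : X.Nonempty) :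
    ∃ T : SetTree V, T.root = X ∧ T.Valid := by
  induction X, Set.toFinite X using Set.Finite.induction_on with
  | empty => exact absurd hX Set.not_nonempty_empty
  | @insert a X ha _ ih =>
    rcases X.eq_empty_or_nonempty with rfl | hX
    · exact ⟨.leaf (insert a ∅), rfl, by simp [SetTree.Valid]⟩
    · obtain ⟨T, hT, hTv⟩ := ih hX
      refine ⟨.node (insert a X) (.leaf {a}) T, rfl, ?_, ?_, ?_, hTv⟩
      · rw [hT]
        rfl
      · rw [hT]
        exact Set.singleton_inter_eq_empty.2 ha
      · simp [SetTree.Valid]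

theorem SimpleGraph.exists_rankDecomposition {V : Type*} [Fintype V] [Nonempty V]
    {G : SimpleGraph V} {k : ℕ} (hG : G.rankWidth ≤ k) :
    ∃ T : SetTree V, T.IsRankDecomposition ∧ T.width G ≤ k := by
  obtain ⟨T₀, hT₀⟩ := SetTree.exists_valid (Set.univ : Set V) Set.univ_nonempty
  obtain ⟨T, hT, hw⟩ := Nat.sInf_mem
    (s := {w | ∃ T : SetTree V, T.IsRankDecomposition ∧ T.width G = w}) ⟨_, T₀, hT₀, rfl⟩
  exact ⟨T, hT, hw.le.trans hG⟩

/-- A graph can be made connected by possibly flipping all pairs of vertices. -/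
theorem SimpleGraph.exists_flipConn {V ι : Type*} (G : SimpleGraph V) (l : V → ι) :
    ∃ f : ι → ι → Prop, (∀ a b, f a b → f b a) ∧ ∀ u w, G.FlipConn l f u w := by
  by_cases h : ∀ u w, G.FlipConn l (fun _ _ => False) u w
  · exact ⟨_, fun _ _ => id, h⟩
  refine ⟨fun _ _ => True, fun _ _ => id, ?_⟩
  push Not at h
  obtain ⟨a, b, hab⟩ := h
  -- Vertices of different components of `G` are adjacent after flipping everything; two vertices of
  -- the same component are then joined through a third one outside it.
  have hcross : ∀ u w, ¬ G.FlipConn l (fun _ _ => False) u w →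
      G.FlipAdj l (fun _ _ => True) u w := fun u w huw => by
    have := SimpleGraph.adj_iff_of_not_flipConn huw
    simpa [SimpleGraph.FlipAdj] using this
  have hsymm : ∀ {u w}, G.FlipConn l (fun _ _ => False) u w →
      G.FlipConn l (fun _ _ => False) w u := SimpleGraph.FlipConn.symm fun _ _ => id
  intro u w
  by_cases huw : G.FlipConn l (fun _ _ => False) u w
  · obtain ⟨z, hz⟩ : ∃ z, ¬ G.FlipConn l (fun _ _ => False) u z := by
      by_contra hall
      push Not at hall
      exact hab ((hsymm (hall a)).trans (hall b))
    exact (Relation.ReflTransGen.single (hcross _ _ hz)).tail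
      (hcross _ _ fun hzw => hz (huw.trans (hsymm hzw)))
  · exact Relation.ReflTransGen.single (hcross _ _ huw)

/-- Pebble games with enough pebbles identify the coloured graphs of bounded rank width. -/
theorem IsPebbleSystem.exists_iso {V W κ : Type*} [Fintype V] [Finite W] {G : SimpleGraph V}
    {H : SimpleGraph W} {c : V → κ} {d : W → κ} {m k : ℕ} {𝓔 : Set (Set (V × W))}
    (hE : IsPebbleSystem G H c d m 𝓔) (h0 : ∅ ∈ 𝓔) (hm : 3 * k + 3 ≤ m)
    (hG : G.rankWidth ≤ k) : ∃ e : G ≃g H, ∀ v, d (e v) = c v := by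
  -- This bijection settles the graph without vertices and otherwise supplies the partner `g v`.
  obtain ⟨g, hg⟩ := hE.extend ∅ h0 (by simp; omega)
  rcases isEmpty_or_nonempty V with hV | ⟨⟨v⟩⟩
  · exact ⟨⟨g, fun {a} => hV.elim a⟩, fun v => hV.elim v⟩
  have : Nonempty V := ⟨v⟩
  obtain ⟨T, ⟨hroot, hT⟩, hw⟩ := G.exists_rankDecomposition hG
  obtain ⟨f, hf, hconn⟩ := G.exists_flipConn (typeLeft G c (∅ : Set (V × W)))
  obtain ⟨φ, hφ, -⟩ := hE.exists_typedIso hm T hT hw (A := ∅) (B := ∅)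
    (by rw [hroot]; exact G.isSplitPair_univ) h0 (by simp) hf
    (by rw [hroot]; exact fun _ _ w hw => absurd (Set.mem_univ w) hw)
    (by rw [hroot]; exact Set.mem_univ v) (hg v)
  obtain ⟨g', -, -, hinv⟩ := hE.exists_equiv_of_invariant (by simp; omega) (hg v)
  have hbij : Function.Bijective φ := by
    rw [← Set.bijOn_univ]
    have h1 : {y | G.FlipConn (typeLeft G c (∅ : Set (V × W))) f v y} = Set.univ :=
      Set.eq_univ_of_forall (hconn v)
    have h2 : {y | H.FlipConn (typeRight G H c d (∅ : Set (V × W))) f (g v) y} = Set.univ := by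
      refine Set.eq_univ_of_forall fun y => ?_
      obtain ⟨y, rfl⟩ := g'.surjective y
      exact (hinv _ _ (hE.invariantOver_flipConn (by simp; omega) f) y).1 (hconn v y)
    have := hφ.bijOn
    rwa [h1, h2] at this
  refine ⟨⟨Equiv.ofBijective φ hbij, fun {a b} => ?_⟩, fun w => ?_⟩
  · exact (hφ.adj_iff a (hconn v a) b (hconn v b)).symm
  · exact (colour_eq_of_typeLeft_eq_typeRight (hφ.type_eq w (hconn v w))).1.symm

/-! ## Counting logic and pebble games -/

theorem map_update_some {α β : Type*} (h : ℕ → Option α) (x : ℕ) (p : α) (f : α → β) :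
    (fun y => (Function.update h x (some p) y).map f) =
      Function.update (fun y => (h y).map f) x (some (f p)) := by
  funext y
  by_cases hyx : y = x
  · rw [hyx, Function.update_self, Function.update_self]
    rfl
  · rw [Function.update_of_ne hyx, Function.update_of_ne hyx]

theorem exists_finset_iff_le_ncard {U : Type*} [Finite U] (s : Set U) (i : ℕ) :
    (∃ f : Finset U, f.card = i ∧ ∀ u ∈ f, u ∈ s) ↔ i ≤ s.ncard := by
  constructor
  · rintro ⟨f, rfl, hf⟩
    rw [← Set.ncard_coe_finset]
    exact Set.ncard_le_ncard (fun u hu => hf u hu) (Set.toFinite _)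
  · intro hi
    rw [Set.ncard_eq_toFinset_card s (Set.toFinite s)] at hi
    obtain ⟨f, hf, hfi⟩ := Finset.exists_subset_card_eq hi
    exact ⟨f, hfi, fun u hu => by simpa using hf hu⟩

namespace CFormula

variable {C V W : Type*}

theorem realize_congr (G : SimpleGraph V) (P : C → V → Prop) (φ : CFormula C)
    {a b : ℕ → Option V} (h : ∀ x ∈ φ.freeVars, a x = b x) :
    Realize G P a φ ↔ Realize G P b φ := by
  have hupd : ∀ (x : ℕ) (v : V) (ψ : CFormula C) {a b : ℕ → Option V},
      (∀ y ∈ ψ.freeVars.erase x, a y = b y) →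
      ∀ y ∈ ψ.freeVars, Function.update a x (some v) y = Function.update b x (some v) y := by
    intro x v ψ a b h y hy
    by_cases hyx : y = x
    · rw [hyx, Function.update_self, Function.update_self]
    · rw [Function.update_of_ne hyx, Function.update_of_ne hyx]
      exact h y (Finset.mem_erase.2 ⟨hyx, hy⟩)
  induction φ generalizing a b with
  | eq x y => simp only [Realize, h x (by simp [freeVars]), h y (by simp [freeVars])]
  | edge x y => simp only [Realize, h x (by simp [freeVars]), h y (by simp [freeVars])]
  | colour c x => simp only [Realize, h x (by simp [freeVars])]
  | neg φ ih => exact not_congr (ih h)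
  | and φ ψ ih₁ ih₂ =>
    exact and_congr (ih₁ fun x hx => h x (Finset.mem_union_left _ hx))
      (ih₂ fun x hx => h x (Finset.mem_union_right _ hx))
  | or φ ψ ih₁ ih₂ =>
    exact or_congr (ih₁ fun x hx => h x (Finset.mem_union_left _ hx))
      (ih₂ fun x hx => h x (Finset.mem_union_right _ hx))
  | ex x φ ih => exact exists_congr fun v => ih (hupd x v φ h)
  | all x φ ih => exact forall_congr' fun v => ih (hupd x v φ h)
  | exGE i x φ ih =>
    exact exists_congr fun s => and_congr_right fun _ =>
      forall_congr' fun v => imp_congr_right fun _ => ih (hupd x v φ h)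

theorem realize_iso {G : SimpleGraph V} {H : SimpleGraph W} {P : C → V → Prop}
    {P' : C → W → Prop} (e : G ≃g H) (he : ∀ c v, P c v ↔ P' c (e v)) (φ : CFormula C)
    (a : ℕ → Option V) : Realize G P a φ ↔ Realize H P' (fun x => (a x).map e) φ := by
  induction φ generalizing a with
  | eq x y =>
    simp only [Realize, Option.map_eq_some_iff]
    constructor
    · rintro ⟨v, h1, h2⟩
      exact ⟨e v, ⟨v, h1, rfl⟩, v, h2, rfl⟩
    · rintro ⟨_, ⟨v, h1, rfl⟩, w, h2, h3⟩
      exact ⟨v, h1, e.injective h3 ▸ h2⟩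
  | edge x y =>
    simp only [Realize, Option.map_eq_some_iff]
    constructor
    · rintro ⟨v, w, h1, h2, h3⟩
      exact ⟨e v, e w, ⟨v, h1, rfl⟩, ⟨w, h2, rfl⟩, e.map_adj_iff.2 h3⟩
    · rintro ⟨_, _, ⟨v, h1, rfl⟩, ⟨w, h2, rfl⟩, h3⟩
      exact ⟨v, w, h1, h2, e.map_adj_iff.1 h3⟩
  | colour c x =>
    simp only [Realize, Option.map_eq_some_iff]
    constructor
    · rintro ⟨v, h1, h2⟩
      exact ⟨e v, ⟨v, h1, rfl⟩, (he c v).1 h2⟩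
    · rintro ⟨_, ⟨v, h1, rfl⟩, h2⟩
      exact ⟨v, h1, (he c v).2 h2⟩
  | neg φ ih => exact not_congr (ih a)
  | and φ ψ ih₁ ih₂ => exact and_congr (ih₁ a) (ih₂ a)
  | or φ ψ ih₁ ih₂ => exact or_congr (ih₁ a) (ih₂ a)
  | ex x φ ih =>
    simp only [Realize, ih, map_update_some]
    exact ⟨fun ⟨v, h⟩ => ⟨e v, h⟩, fun ⟨w, h⟩ => ⟨e.symm w, by rwa [e.apply_symm_apply]⟩⟩
  | all x φ ih =>
    simp only [Realize, ih, map_update_some]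
    exact ⟨fun h w => e.apply_symm_apply w ▸ h (e.symm w), fun h v => h (e v)⟩
  | exGE i x φ ih =>
    simp only [Realize, ih, map_update_some]
    constructor
    · rintro ⟨s, hs, h⟩
      refine ⟨s.map e.toEquiv.toEmbedding, by simpa using hs, fun w hw => ?_⟩
      obtain ⟨v, hv, rfl⟩ := Finset.mem_map.1 hw
      exact h v hv
    · rintro ⟨s, hs, h⟩
      refine ⟨s.map e.symm.toEquiv.toEmbedding, by simpa using hs, fun v hv => ?_⟩
      obtain ⟨w, hw, rfl⟩ := Finset.mem_map.1 hv
      have := h w hw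
      rwa [← e.apply_symm_apply w] at this

/-- A sentence that is always true. -/
def verum : CFormula C := all 0 (eq 0 0)

theorem realize_verum (G : SimpleGraph V) (P : C → V → Prop) (a : ℕ → Option V) :
    Realize G P a verum := fun v => ⟨v, by simp, by simp⟩

/-- The conjunction of a list of formulas. -/
def conj (l : List (CFormula C)) : CFormula C := l.foldr and verum

theorem realize_conj (G : SimpleGraph V) (P : C → V → Prop) (a : ℕ → Option V)
    (l : List (CFormula C)) : Realize G P a (conj l) ↔ ∀ φ ∈ l, Realize G P a φ := by
  induction l with
  | nil => simpa [conj] using realize_verum G P a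
  | cons φ l ih =>
    rw [List.forall_mem_cons, ← ih]
    rfl

theorem vars_conj_subset {m : ℕ} (hm : 0 < m) {l : List (CFormula C)}
    (h : ∀ φ ∈ l, φ.vars ⊆ Finset.range m) : (conj l).vars ⊆ Finset.range m := by
  induction l with
  | nil =>
    intro x hx
    simp only [conj, List.foldr_nil, verum, vars, Finset.mem_insert, Finset.mem_singleton,
      or_self] at hx
    simpa [hx] using hm
  | cons φ l ih =>
    rw [List.forall_mem_cons] at h
    exact Finset.union_subset h.1 (ih h.2)

theorem mem_freeVars_conj {x : ℕ} {l : List (CFormula C)} (h : x ∈ (conj l).freeVars) :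
    ∃ φ ∈ l, x ∈ φ.freeVars := by
  induction l with
  | nil => simp [conj, verum, freeVars] at h
  | cons φ l ih =>
    rcases Finset.mem_union.1 h with h | h
    · exact ⟨φ, by simp, h⟩
    · obtain ⟨ψ, hψ, hx⟩ := ih h
      exact ⟨ψ, by simp [hψ], hx⟩

end CFormula

theorem exists_equiv_of_fibers {V W T : Type*} [Finite V] [Finite W] (τ : V → T) (τ' : W → T)
    (h : ∀ t, {v | τ v = t}.ncard = {w | τ' w = t}.ncard) : ∃ e : V ≃ W, ∀ v, τ' (e v) = τ v := by
  have hf : ∀ t, Nonempty ({v // τ v = t} ≃ {w // τ' w = t}) := fun t => Finite.card_eq.1 (h t)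
  have f := fun t => (hf t).some
  refine ⟨(Equiv.sigmaFiberEquiv τ).symm.trans ((Equiv.sigmaCongrRight f).trans
    (Equiv.sigmaFiberEquiv τ')), fun v => ?_⟩
  exact (f (τ v) ⟨v, rfl⟩).2

namespace CFormula

variable {C V W : Type*}

/-- If no formula with one designated free variable distinguishes two expansions, then a
bijection matches the vertices that satisfy the same formulas. -/
theorem exists_equiv_of_exGE [Finite V] [Finite W] {G : SimpleGraph V} {H : SimpleGraph W}
    {P : C → V → Prop} {P' : C → W → Prop} {a : ℕ → Option V} {b : ℕ → Option W} {m x : ℕ}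
    (hx : x < m) {D : Set ℕ}
    (hab : ∀ φ : CFormula C, φ.vars ⊆ Finset.range m → (∀ y ∈ φ.freeVars, y ∈ D) →
      (Realize G P a φ ↔ Realize H P' b φ)) :
    ∃ e : V ≃ W, ∀ v, ∀ φ : CFormula C, φ.vars ⊆ Finset.range m →
      (∀ y ∈ φ.freeVars, y = x ∨ y ∈ D) →
      (Realize G P (Function.update a x (some v)) φ ↔
        Realize H P' (Function.update b x (some (e v))) φ) := by
  classical
  -- Vertices are sorted by the admissible formulas they satisfy. Only finitely many such types are
  -- realised, so each is isolated by a finite conjunction, and counting quantifiers compare the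
  -- numbers of vertices of each type.
  let Adm : CFormula C → Prop := fun φ => φ.vars ⊆ Finset.range m ∧
    ∀ y ∈ φ.freeVars, y = x ∨ y ∈ D
  let τ : V → Set (CFormula C) := fun v =>
    {φ | Adm φ ∧ Realize G P (Function.update a x (some v)) φ}
  let τ' : W → Set (CFormula C) := fun w =>
    {φ | Adm φ ∧ Realize H P' (Function.update b x (some w)) φ}
  have hfin : (Set.range τ ∪ Set.range τ').Finite :=
    (Set.finite_range τ).union (Set.finite_range τ')
  have hneg : ∀ t ∈ Set.range τ ∪ Set.range τ', ∀ φ, Adm φ → (neg φ ∈ t ↔ φ ∉ t) := by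
    rintro t (⟨v, rfl⟩ | ⟨w, rfl⟩) φ hφ
    · exact ⟨fun h h' => h.2 h'.2, fun h => ⟨hφ, fun h' => h ⟨hφ, h'⟩⟩⟩
    · exact ⟨fun h h' => h.2 h'.2, fun h => ⟨hφ, fun h' => h ⟨hφ, h'⟩⟩⟩
  have hadm : ∀ t ∈ Set.range τ ∪ Set.range τ', ∀ φ ∈ t, Adm φ := by
    rintro t (⟨v, rfl⟩ | ⟨w, rfl⟩) φ hφ
    · exact hφ.1
    · exact hφ.1
  have hdist : ∀ t ∈ Set.range τ ∪ Set.range τ', ∀ t' ∈ Set.range τ ∪ Set.range τ', t ≠ t' →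
      ∃ φ ∈ t, φ ∉ t' := by
    intro t ht t' ht' hne
    by_contra hall
    push Not at hall
    refine hne (Set.Subset.antisymm hall fun φ hφ => ?_)
    by_contra hφt
    have hA := hadm t' ht' φ hφ
    exact (hneg t' ht' φ hA).1 (hall _ ((hneg t ht φ hA).2 hφt)) hφ
  have hiso : ∀ t ∈ Set.range τ ∪ Set.range τ', ∃ ψ, Adm ψ ∧
      (∀ v, Realize G P (Function.update a x (some v)) ψ ↔ τ v = t) ∧
      ∀ w, Realize H P' (Function.update b x (some w)) ψ ↔ τ' w = t := by
    intro t ht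
    have hd : ∀ t' : {t' // t' ∈ hfin.toFinset ∧ t ≠ t'}, ∃ φ ∈ t, φ ∉ t'.1 := fun t' =>
      hdist t ht t'.1 (hfin.mem_toFinset.1 t'.2.1) t'.2.2
    choose δ hδ hδ' using hd
    have : Finite {t' // t' ∈ hfin.toFinset ∧ t ≠ t'} :=
      Finite.of_injective (fun t' => (⟨t'.1, t'.2.1⟩ : hfin.toFinset))
        fun s s' h => Subtype.ext (Subtype.mk.inj h)
    have := Fintype.ofFinite {t' // t' ∈ hfin.toFinset ∧ t ≠ t'}
    refine ⟨conj (Finset.univ.toList.map δ), ⟨?_, ?_⟩, ?_, ?_⟩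
    · refine vars_conj_subset (by omega) fun φ hφ => ?_
      obtain ⟨t', -, rfl⟩ := List.mem_map.1 hφ
      exact (hadm t ht _ (hδ t')).1
    · intro y hy
      obtain ⟨φ, hφ, hy⟩ := mem_freeVars_conj hy
      obtain ⟨t', -, rfl⟩ := List.mem_map.1 hφ
      exact (hadm t ht _ (hδ t')).2 y hy
    · intro v
      rw [realize_conj]
      constructor
      · intro h
        by_contra hne
        have hmem : τ v ∈ hfin.toFinset ∧ t ≠ τ v :=
          ⟨hfin.mem_toFinset.2 (Or.inl ⟨v, rfl⟩), Ne.symm hne⟩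
        refine hδ' ⟨_, hmem⟩ ⟨hadm t ht _ (hδ ⟨_, hmem⟩), h _ (List.mem_map.2 ⟨_, ?_, rfl⟩)⟩
        simp
      · rintro hv φ hφ
        obtain ⟨t', -, rfl⟩ := List.mem_map.1 hφ
        have := hδ t'
        rw [← hv] at this
        exact this.2
    · intro v
      rw [realize_conj]
      constructor
      · intro h
        by_contra hne
        have hmem : τ' v ∈ hfin.toFinset ∧ t ≠ τ' v :=
          ⟨hfin.mem_toFinset.2 (Or.inr ⟨v, rfl⟩), Ne.symm hne⟩
        refine hδ' ⟨_, hmem⟩ ⟨hadm t ht _ (hδ ⟨_, hmem⟩), h _ (List.mem_map.2 ⟨_, ?_, rfl⟩)⟩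
        simp
      · rintro hv φ hφ
        obtain ⟨t', -, rfl⟩ := List.mem_map.1 hφ
        have := hδ t'
        rw [← hv] at this
        exact this.2
  have hcount : ∀ t, {v | τ v = t}.ncard = {w | τ' w = t}.ncard := by
    intro t
    by_cases ht : t ∈ Set.range τ ∪ Set.range τ'
    · obtain ⟨ψ, hψ, h1, h2⟩ := hiso t ht
      have hex : ∀ i, Realize G P a (exGE i x ψ) ↔ Realize H P' b (exGE i x ψ) := by
        intro i
        refine hab _ ?_ fun y hy => ?_
        · exact Finset.insert_subset (by simpa using hx) hψ.1
        · obtain ⟨hyx, hy⟩ := Finset.mem_erase.1 hy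
          exact (hψ.2 y hy).resolve_left hyx
      simp only [Realize, h1, h2] at hex
      have hex' : ∀ i, i ≤ {v | τ v = t}.ncard ↔ i ≤ {w | τ' w = t}.ncard := fun i =>
        (exists_finset_iff_le_ncard {v | τ v = t} i).symm.trans
          ((hex i).trans (exists_finset_iff_le_ncard {w | τ' w = t} i))
      exact le_antisymm ((hex' _).1 le_rfl) ((hex' _).2 le_rfl)
    · have h1 : {v | τ v = t} = ∅ :=
        Set.eq_empty_of_forall_notMem fun v hv => ht (Or.inl ⟨v, hv⟩)
      have h2 : {v | τ' v = t} = ∅ :=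
        Set.eq_empty_of_forall_notMem fun v hv => ht (Or.inr ⟨v, hv⟩)
      rw [h1, h2, Set.ncard_empty, Set.ncard_empty]
  obtain ⟨e, he⟩ := exists_equiv_of_fibers τ τ' hcount
  refine ⟨e, fun v φ hφ hφ' => ?_⟩
  have := Set.ext_iff.1 (he v) φ
  exact ⟨fun h => (this.2 ⟨⟨hφ, hφ'⟩, h⟩).2, fun h => (this.1 ⟨⟨hφ, hφ'⟩, h⟩).2⟩

/-- The sets of pairs of pebbled vertices such that no formula with variables below `m`
distinguishes the two sides. -/
def equivPositions (G : SimpleGraph V) (H : SimpleGraph W) (P : C → V → Prop)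
    (P' : C → W → Prop) (m : ℕ) : Set (Set (V × W)) :=
  {S | ∃ h : ℕ → Option (V × W), (∀ x, h x ≠ none → x < m) ∧ (∀ p, p ∈ S ↔ ∃ x, h x = some p) ∧
    (∀ x y p, h x = some p → h y = some p → x = y) ∧
    ∀ φ : CFormula C, φ.vars ⊆ Finset.range m → (∀ x ∈ φ.freeVars, h x ≠ none) →
      (Realize G P (fun x => (h x).map Prod.fst) φ ↔
        Realize H P' (fun x => (h x).map Prod.snd) φ)}

theorem isPebbleSystem_equivPositions [Finite V] [Finite W] (G : SimpleGraph V)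
    (H : SimpleGraph W) (P : C → V → Prop) (P' : C → W → Prop) (m : ℕ) :
    IsPebbleSystem G H (fun v => {c | P c v}) (fun w => {c | P' c w}) m
      (equivPositions G H P P' m) where
  mono := by
    classical
    rintro S ⟨h, hm, hS, hi, hφ⟩ S' hS'
    have hsome : ∀ x p, (if ∃ p ∈ S', h x = some p then h x else none) = some p ↔
        p ∈ S' ∧ h x = some p := by
      intro x p
      split_ifs with hx
      · obtain ⟨q, hq, hxq⟩ := hx
        constructor
        · intro hp
          rw [hxq] at hp
          exact ⟨Option.some.inj hp ▸ hq, hxq.trans hp⟩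
        · exact fun hp => hp.2
      · exact ⟨fun hp => by simp at hp, fun hp => absurd ⟨p, hp⟩ hx⟩
    have hne : ∀ x, (if ∃ p ∈ S', h x = some p then h x else none) ≠ none →
        (if ∃ p ∈ S', h x = some p then h x else none) = h x := by
      intro x hx
      split_ifs at hx ⊢ <;> simp_all
    refine ⟨fun x => if ∃ p ∈ S', h x = some p then h x else none, ?_, ?_, ?_, ?_⟩
    · intro x hx
      refine hm x ?_
      rw [← hne x hx]
      exact hx
    · intro p
      simp only [hsome]
      constructor
      · intro hp
        obtain ⟨x, hx⟩ := (hS p).1 (hS' hp)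
        exact ⟨x, hp, hx⟩
      · rintro ⟨x, hp, -⟩
        exact hp
    · intro x y p hx hy
      exact hi x y p ((hsome x p).1 hx).2 ((hsome y p).1 hy).2
    · intro φ hv hf
      rw [realize_congr G P φ (b := fun x => (h x).map Prod.fst) fun x hx => by
          simp only [hne x (hf x hx)],
        realize_congr H P' φ (b := fun x => (h x).map Prod.snd) fun x hx => by
          simp only [hne x (hf x hx)]]
      exact hφ φ hv fun x hx => by
        rw [← hne x (hf x hx)]
        exact hf x hx
  eq_iff := by
    rintro S ⟨h, hm, hS, hi, hφ⟩ p hp q hq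
    obtain ⟨x, hx⟩ := (hS p).1 hp
    obtain ⟨y, hy⟩ := (hS q).1 hq
    have hxm := hm x (by simp [hx])
    have hym := hm y (by simp [hy])
    have := hφ (eq x y) (by simp [vars, Finset.insert_subset_iff, hxm, hym])
      (by simp [freeVars, hx, hy])
    simpa [Realize, hx, hy, eq_comm] using this
  adj_iff := by
    rintro S ⟨h, hm, hS, hi, hφ⟩ p hp q hq
    obtain ⟨x, hx⟩ := (hS p).1 hp
    obtain ⟨y, hy⟩ := (hS q).1 hq
    have hxm := hm x (by simp [hx])
    have hym := hm y (by simp [hy])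
    have := hφ (edge x y) (by simp [vars, Finset.insert_subset_iff, hxm, hym])
      (by simp [freeVars, hx, hy])
    simpa [Realize, hx, hy] using this
  colour_eq := by
    rintro S ⟨h, hm, hS, hi, hφ⟩ p hp
    obtain ⟨x, hx⟩ := (hS p).1 hp
    have hxm := hm x (by simp [hx])
    ext c
    have := hφ (colour c x) (by simp [vars, hxm]) (by simp [freeVars, hx])
    simpa [Realize, hx] using this
  extend := by
    classical
    rintro S ⟨h, hm, hS, hi, hφ⟩ hcard
    -- If all `m` variables were in use, they would carry distinct pairs, contradicting `S.ncard <
    -- m`.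
    obtain ⟨x, hxm, hx⟩ : ∃ x < m, h x = none := by
      by_contra hall
      push Not at hall
      have hall' : ∀ x : Fin m, ∃ p, h x = some p := fun x =>
        Option.ne_none_iff_exists'.1 (hall x x.2)
      choose p hp using hall'
      have hinj : Function.Injective p := fun x y hxy =>
        Fin.ext (hi x y (p x) (hp x) (hxy ▸ hp y))
      have hsub : Set.range p ⊆ S := by
        rintro _ ⟨x, rfl⟩
        exact (hS _).2 ⟨x, hp x⟩
      have h1 := Set.ncard_le_ncard hsub (Set.toFinite _)
      rw [← Set.image_univ, Set.ncard_image_of_injective _ hinj, Set.ncard_univ,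
        Nat.card_fin] at h1
      omega
    obtain ⟨e, he⟩ := exists_equiv_of_exGE hxm (D := {x | h x ≠ none}) hφ
    refine ⟨e, fun v => ?_⟩
    -- A pair already pebbled must not receive a second variable, since `h` is required to be
    -- injective on assigned variables.
    by_cases hv : (v, e v) ∈ S
    · rw [Set.insert_eq_of_mem hv]
      exact ⟨h, hm, hS, hi, hφ⟩
    have hsome : ∀ y p, Function.update h x (some (v, e v)) y = some p ↔
        y = x ∧ p = (v, e v) ∨ h y = some p := by
      intro y p
      by_cases hyx : y = x
      · subst hyx
        simp [hx, eq_comm]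
      · simp [hyx]
    refine ⟨Function.update h x (some (v, e v)), ?_, ?_, ?_, ?_⟩
    · intro y hy
      by_cases hyx : y = x
      · rwa [hyx]
      · rw [Function.update_of_ne hyx] at hy
        exact hm y hy
    · intro p
      simp only [hsome, Set.mem_insert_iff, hS]
      constructor
      · rintro (rfl | ⟨y, hy⟩)
        · exact ⟨x, Or.inl ⟨rfl, rfl⟩⟩
        · exact ⟨y, Or.inr hy⟩
      · rintro ⟨y, ⟨-, hp⟩ | hy⟩
        · exact Or.inl hp
        · exact Or.inr ⟨y, hy⟩
    · intro y z p hy hz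
      rw [hsome] at hy hz
      rcases hy with ⟨hyx, hp⟩ | hy <;> rcases hz with ⟨hzx, hp'⟩ | hz
      · exact hyx.trans hzx.symm
      · exact absurd ((hS _).2 ⟨z, hp ▸ hz⟩) hv
      · exact absurd ((hS _).2 ⟨y, hp' ▸ hy⟩) hv
      · exact hi y z p hy hz
    · intro φ hφv hφf
      rw [map_update_some, map_update_some]
      refine he v φ hφv fun y hy => ?_
      by_cases hyx : y = x
      · exact Or.inl hyx
      · have := hφf y hy
        rw [Function.update_of_ne hyx] at this
        exact Or.inr this

theorem empty_mem_equivPositions {G : SimpleGraph V} {H : SimpleGraph W} {P : C → V → Prop}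
    {P' : C → W → Prop} {m : ℕ}
    (h : ∀ φ : CFormula C, φ.vars ⊆ Finset.range m → φ.freeVars = ∅ →
      (Realize G P (fun _ => none) φ ↔ Realize H P' (fun _ => none) φ)) :
    ∅ ∈ equivPositions G H P P' m := by
  refine ⟨fun _ => none, by simp, by simp, by simp, fun φ hφ hf => h φ hφ ?_⟩
  exact Finset.eq_empty_of_forall_notMem fun x hx => hf x hx rfl

/-- The sentence saying that there are exactly `n` vertices. -/
def cardEq (n : ℕ) : CFormula C := and (exGE n 0 (eq 0 0)) (neg (exGE (n + 1) 0 (eq 0 0)))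

theorem realize_cardEq [Finite W] (H : SimpleGraph W) (P : C → W → Prop) (a : ℕ → Option W)
    (n : ℕ) : Realize H P a (cardEq n) ↔ Nat.card W = n := by
  have := Fintype.ofFinite W
  have key : ∀ i, Realize H P a (exGE i 0 (eq 0 0)) ↔ i ≤ Nat.card W := by
    intro i
    simp only [Realize, Function.update_self, Option.some.injEq, and_self, exists_eq', implies_true,
      and_true, Nat.card_eq_fintype_card]
    constructor
    · rintro ⟨s, rfl⟩
      exact s.card_le_univ
    · intro hi
      obtain ⟨s, -, hs⟩ := Finset.exists_subset_card_eq (s := (Finset.univ : Finset W)) hi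
      exact ⟨s, hs⟩
  change Realize H P a (exGE n 0 (eq 0 0)) ∧ ¬ Realize H P a (exGE (n + 1) 0 (eq 0 0)) ↔ _
  rw [key, key]
  omega

/-- Every coloured graph of bounded rank width is characterised by a sentence with few
variables. -/
theorem exists_sentence [Fintype V] [Finite C] (G : SimpleGraph V) (P : C → V → Prop) {k m : ℕ}
    (hm : 3 * k + 3 ≤ m) (hG : G.rankWidth ≤ k) :
    ∃ φ : CFormula C, φ.IsSentenceOfC m ∧
      ∀ (W : Type*) [Finite W] (H : SimpleGraph W) (P' : C → W → Prop),
        Realize H P' (fun _ => none) φ ↔ ∃ e : G ≃g H, ∀ c v, P' c (e v) ↔ P c v := by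
  classical
  -- Candidates on a fixed vertex set form a finite type that represents all coloured graphs of the
  -- right order. If no sentence separates a candidate from `G`, the pebble game yields an
  -- isomorphism, and then even `verum` has the required property.
  have hdist : ∀ s : SimpleGraph (Fin (Nat.card V)) × (C → Fin (Nat.card V) → Prop),
      ∃ φ : CFormula C, φ.vars ⊆ Finset.range m ∧ φ.freeVars = ∅ ∧
        Realize G P (fun _ => none) φ ∧ (Realize s.1 s.2 (fun _ => none) φ →
          ∃ e : G ≃g s.1, ∀ c v, s.2 c (e v) ↔ P c v) := by
    rintro ⟨H, P'⟩
    by_contra hall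
    push Not at hall
    have heq : ∀ φ : CFormula C, φ.vars ⊆ Finset.range m → φ.freeVars = ∅ →
        (Realize G P (fun _ => none) φ ↔ Realize H P' (fun _ => none) φ) := fun φ hv hf =>
      ⟨fun h => (hall φ hv hf h).1, fun h => by_contra fun h' => (hall (neg φ) hv hf h').1 h⟩
    obtain ⟨e, he⟩ := (isPebbleSystem_equivPositions G H P P' m).exists_iso
      (empty_mem_equivPositions heq) hm hG
    have hv : (verum : CFormula C).vars ⊆ Finset.range m :=
      vars_conj_subset (l := []) (by omega) (by simp)
    obtain ⟨c, v, hcv⟩ := (hall verum hv (by simp [verum, freeVars]) (realize_verum _ _ _)).2 e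
    have := Set.ext_iff.1 (he v) c
    simp only [Set.mem_ofPred_eq] at this
    tauto
  choose δ hδv hδf hδG hδ using hdist
  have := Fintype.ofFinite (SimpleGraph (Fin (Nat.card V)) × (C → Fin (Nat.card V) → Prop))
  let φ : CFormula C := and (cardEq (Nat.card V)) (conj (Finset.univ.toList.map δ))
  have hφG : Realize G P (fun _ => none) φ := by
    refine ⟨(realize_cardEq _ _ _ _).2 rfl, (realize_conj _ _ _ _).2 fun ψ hψ => ?_⟩
    obtain ⟨s, -, rfl⟩ := List.mem_map.1 hψ
    exact hδG s
  refine ⟨φ, ⟨?_, ?_⟩, ?_⟩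
  · refine Finset.eq_empty_of_forall_notMem fun x hx => ?_
    rcases Finset.mem_union.1 hx with hx | hx
    · simp [cardEq, freeVars] at hx
    · obtain ⟨ψ, hψ, hx⟩ := mem_freeVars_conj hx
      obtain ⟨s, -, rfl⟩ := List.mem_map.1 hψ
      rw [hδf] at hx
      simp at hx
  · have hsub : φ.vars ⊆ Finset.range m := by
      refine Finset.union_subset ?_ (vars_conj_subset (by omega) fun ψ hψ => ?_)
      · intro x hx
        simp only [cardEq, vars, Finset.mem_union, Finset.mem_insert, Finset.mem_singleton,
          or_self] at hx
        simp only [hx, Finset.mem_range]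
        omega
      · obtain ⟨s, -, rfl⟩ := List.mem_map.1 hψ
        exact hδv s
    exact (Finset.card_le_card hsub).trans (Finset.card_range m).le
  intro W _ H P'
  constructor
  · rintro ⟨h1, h2⟩
    rw [realize_cardEq] at h1
    -- `H` is copied to the fixed vertex set, where its own distinguishing sentence occurs in the
    -- conjunction.
    have f : W ≃ Fin (Nat.card V) := h1 ▸ Finite.equivFin W
    let H₂ : SimpleGraph (Fin (Nat.card V)) := H.map f.toEmbedding
    let ι : H ≃g H₂ := SimpleGraph.Iso.map f H
    let P₂ : C → Fin (Nat.card V) → Prop := fun c x => P' c (ι.symm x)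
    have hι : ∀ c w, P' c w ↔ P₂ c (ι w) := fun c w => by
      simp only [P₂, RelIso.symm_apply_apply]
    obtain ⟨e, he⟩ := hδ (H₂, P₂) ((realize_iso ι hι _ _).1 ((realize_conj _ _ _ _).1 h2 _
      (List.mem_map.2 ⟨_, by simp, rfl⟩)))
    refine ⟨e.trans ι.symm, fun c v => ?_⟩
    exact he c v
  · rintro ⟨e, he⟩
    exact (realize_iso e (fun c v => (he c v).symm) φ _).1 hφG

end CFormula

theorem mainTheorem5 {V : Type*} [Fintype V] (G : SimpleGraph V) (k : ℕ)
    (hG : G.rankWidth ≤ k) :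
    (∃ φ : CFormula Empty, φ.IsSentenceOfC (3 * k + 5) ∧
      ∀ (W : Type*) [Finite W] (H : SimpleGraph W),
        φ.Models H ↔ Nonempty (G ≃g H)) ∧
    (∀ (C : Type*) [Finite C] (χ : V → C),
      ∃ φ : CFormula C, φ.IsSentenceOfC (3 * k + 5) ∧
        ∀ (W : Type*) [Finite W] (H : SimpleGraph W) (χ' : W → C),
          φ.ModelsColoured H χ' ↔ ∃ e : G ≃g H, ∀ v, χ' (e v) = χ v) := by
  constructor
  -- The argument needs only `3 * k + 3` variables, so `3 * k + 5` leaves two to spare.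
  · obtain ⟨φ, hφ, h⟩ := CFormula.exists_sentence G (fun (c : Empty) _ => c.elim)
      (m := 3 * k + 5) (by omega) hG
    refine ⟨φ, hφ, fun W _ H => (h W H _).trans ?_⟩
    exact ⟨fun ⟨e, _⟩ => ⟨e⟩, fun ⟨e⟩ => ⟨e, fun c => c.elim⟩⟩
  · intro C _ χ
    obtain ⟨φ, hφ, h⟩ := CFormula.exists_sentence G (fun (c : C) v => χ v = c)
      (m := 3 * k + 5) (by omega) hG
    refine ⟨φ, hφ, fun W _ H χ' => (h W H _).trans ?_⟩
    exact exists_congr fun e => ⟨fun h v => (h _ v).2 rfl, fun h c v => by rw [h]⟩
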